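/- All graphs are finite and simple. For a graph $G$ on $n$ vertices let $Q(G)=D(G)+A(G)$ be its signless Laplacian matrix ($D$ the diagonal matrix of vertex degrees, $A$ the adjacency matrix), with eigenvalues $q_1,\dots,q_n$ counted with multiplicity, and let $SLEE(G)=\sum_{i=1}^n e^{q_i}$. A unicyclic graph is a connected graph with as many edges as vertices; it contains exactly one cycle. Let $C_m$ be the cycle on $m$ vertices and, for $n\ge 4$, let $G_{(2)}$ be the $n$-vertex graph obtained from $C_{n-1}$ by attaching one pendant vertex to one of its vertices. Theorem. Let $G$ be a unicyclic graph on $n$ vertices whose unique cycle has length $q$. If $q<n$, then $$SLEE(C_q)<SLEE(G_{(2)}),\qquad SLEE(C_n)<SLEE(G_{(2)})\le SLEE(G),$$ with equality $SLEE(G_{(2)})=SLEE(G)$ if and only if $G\cong G_{(2)}$, which holds if and only if $q=n-1$. Consequently, for such $n$ (necessarily $n\ge 4$, and every $n\ge4$ occurs), among all unicyclic graphs on $n$ vertices (which include $C_n$ and $G_{(2)}$) the cycle $C_n$ is the unique one with the smallest $SLEE$ and $G_{(2)}$ is the unique one with the second smallest: every $n$-vertex unicyclic graph $H$ satisfies $H\cong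 C_n$, or $H\cong G_{(2)}$, or $SLEE(H)>SLEE(G_{(2)})$. -/

import Mathlib

namespace SimpleGraph

/-- A unicyclic graph: a connected graph with as many edges as vertices. -/
def IsUnicyclic {V : Type*} (G : SimpleGraph V) : Prop :=
  G.Connected ∧ Nat.card G.edgeSet = Nat.card V

section SignlessLaplacian

variable {V : Type*} [Fintype V] [DecidableEq V] (G : SimpleGraph V) [DecidableRel G.Adj]

/-- The signless Laplacian matrix `Q = D + A` of a finite graph. -/
def signlessLapMatrix : Matrix V V ℝ := G.degMatrix ℝ + G.adjMatrix ℝ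

theorem isHermitian_signlessLapMatrix : G.signlessLapMatrix.IsHermitian :=
  (G.isHermitian_degMatrix ℝ).add (G.isHermitian_adjMatrix ℝ)

/-- The signless Laplacian Estrada index: the sum of `exp q` over the eigenvalues `q` of the
signless Laplacian matrix, counted with multiplicity. -/
noncomputable def SLEE : ℝ :=
  ∑ i : V, Real.exp (G.isHermitian_signlessLapMatrix.eigenvalues i)

end SignlessLaplacian

/-- The cycle on the `m` vertices `some 0, …, some (m - 1)`, together with one pendant vertex
`none`, whose only neighbour is `some 0`. -/
def pendantCycle (m : ℕ) : SimpleGraph (Option (Fin m)) where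
  Adj
    | some i, some j => (cycleGraph m).Adj i j
    | none, some j => j.val = 0
    | some i, none => i.val = 0
    | none, none => False
  symm := ⟨by
    rintro (_ | i) (_ | j) h
    · exact h
    · exact h
    · exact h
    · exact SimpleGraph.Adj.symm (G := cycleGraph m) h⟩
  loopless := ⟨by
    rintro (_ | i) h
    · exact h
    · exact (cycleGraph m).irrefl h⟩

instance (m : ℕ) : DecidableRel (pendantCycle m).Adj
  | some i, some j => inferInstanceAs (Decidable ((cycleGraph m).Adj i j))
  | none, some j => inferInstanceAs (Decidable (j.val = 0))
  | some i, none => inferInstanceAs (Decidable (i.val = 0))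
  | none, none => inferInstanceAs (Decidable False)

end SimpleGraph

/-! Write Q = M Mᵀ with M the vertex-edge incidence matrix. Then Mᵀ M = 2I + A, with A the adjacency
matrix of the line graph, so SLEE = e² tr exp A = e² ∑ tr(A^k)/k!, and everything becomes a count of
closed walks in line graphs. In a unicyclic graph, rotate the cycle and send every other vertex one
step towards it; this map φ makes the edges exactly the pairs {v, φ v}, one per vertex, so A may be
indexed by vertices (`exists_isFunctional`, `IsFunctional.SLEE_eq`).

Removing an index w from A removes the closed walks through w. Their number is the k-th coefficient
of X F'/(1 - F), where F = ∑ E_s X^(s+2) and E_s counts excursions from w with s inner steps; it is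
monotone in the E_s (`IsBordering.trace_pow`, `coeff_through_mono`). For w off the cycle, φ w, φ² w,
… is an endless non-backtracking path, so the E_s dominate the Catalan numbers, the excursion
numbers of a half-line. Hence w accounts for at least as many closed walks as one vertex of ℤ, which
adds at least ∑ 1/(b!)² = I_0(2) to tr exp A. Let P_N be the cycle of length N with a pendant
vertex, and t(N) the value of tr exp A for it. A graph on n vertices with cycle length q < n
therefore has tr exp A ≥ t(q) + (n - q - 1) I_0 (`trace_pow_lineMatrix_ge`).

Conversely t(N+1) < t(N) + I_0 (`estrada_pendantMap_succ_lt`): walks winding once around the N-cycle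
give t(N) a surplus 2N I_N ≥ 6 I_N, while all winding walks for N+1 contribute at most 35/6 I_N.
Iterating, t(n-1) < t(q) + (n - q - 1) I_0 if q < n - 1, which is the strict inequality. The cycles
lie below because t(N) ≥ N I_0 + 4 (`estrada_cycleMatrix_lt`). -/

namespace SignlessEstrada

set_option linter.unusedSectionVars false

open Finset PowerSeries Matrix

/-! ### Generating series of first returns, returns and closed walks through a vertex. -/

section ReturnSeries

/-- Coefficientwise nonnegativity of a real power series. -/
def CoeffNonneg (f : ℝ⟦X⟧) : Prop := ∀ k, 0 ≤ coeff k f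

theorem CoeffNonneg.add {f g : ℝ⟦X⟧} (hf : CoeffNonneg f) (hg : CoeffNonneg g) :
    CoeffNonneg (f + g) := fun k => by
  rw [map_add]; exact add_nonneg (hf k) (hg k)

theorem CoeffNonneg.mul {f g : ℝ⟦X⟧} (hf : CoeffNonneg f) (hg : CoeffNonneg g) :
    CoeffNonneg (f * g) := fun k => by
  rw [coeff_mul]; exact Finset.sum_nonneg fun p _ => mul_nonneg (hf _) (hg _)

theorem CoeffNonneg.derivative {f : ℝ⟦X⟧} (hf : CoeffNonneg f) :
    CoeffNonneg (d⁄dX ℝ f) := fun k => by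
  rw [coeff_derivative]; exact mul_nonneg (hf _) (by positivity)

theorem coeffNonneg_X : CoeffNonneg (X : ℝ⟦X⟧) := fun k => by
  rw [coeff_X]; split_ifs <;> norm_num

theorem coeffNonneg_mk {E : ℕ → ℝ} (hE : ∀ s, 0 ≤ E s) : CoeffNonneg (PowerSeries.mk E) :=
  fun k => by rw [coeff_mk]; exact hE k

/-- The generating series of first returns, if `E s` counts the excursions of length `s + 2`. -/
noncomputable def firstReturn (E : ℕ → ℝ) : ℝ⟦X⟧ := X ^ 2 * PowerSeries.mk E

/-- The generating series of all returns. -/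
noncomputable def returns (E : ℕ → ℝ) : ℝ⟦X⟧ := (1 - firstReturn E)⁻¹

/-- The generating series of closed walks through a vertex with excursion numbers `E`. -/
noncomputable def through (E : ℕ → ℝ) : ℝ⟦X⟧ := X * d⁄dX ℝ (firstReturn E) * returns E

variable {E F : ℕ → ℝ}

theorem constantCoeff_firstReturn : constantCoeff (firstReturn E) = 0 := by
  simp [firstReturn]

theorem returns_mul : returns E * (1 - firstReturn E) = 1 :=
  PowerSeries.inv_mul_cancel _ (by simp [constantCoeff_firstReturn])

theorem returns_eq : returns E = 1 + firstReturn E * returns E := by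
  linear_combination returns_mul (E := E)

theorem coeff_firstReturn_mul (Y : ℝ⟦X⟧) (m : ℕ) :
    coeff (m + 2) (firstReturn E * Y) = ∑ l ∈ range (m + 1), E (m - l) * coeff l Y := by
  rw [firstReturn, mul_assoc, coeff_X_pow_mul, mul_comm, coeff_mul,
    Finset.Nat.sum_antidiagonal_eq_sum_range_succ_mk]
  exact Finset.sum_congr rfl fun l _ => by rw [coeff_mk, mul_comm]

/-- In a closed walk through the vertex, some excursion contains the starting time; one of length s
+ 2 can be cut at s + 2 places, which is the factor produced by X d/dX. -/
theorem coeff_through_add_two (m : ℕ) :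
    coeff (m + 2) (through E) =
      ∑ l ∈ range (m + 1), ((m - l : ℕ) + 2 : ℝ) * E (m - l) * coeff l (returns E) := by
  have h : X * d⁄dX ℝ (firstReturn E) = firstReturn fun s => ((s : ℝ) + 2) * E s := by
    ext k
    rcases k with _ | k
    · simp [firstReturn]
    · rw [coeff_succ_X_mul, coeff_derivative, firstReturn, firstReturn]
      rcases k with _ | k
      · simp [coeff_X_pow_mul']
      · rw [show k + 1 + 1 = k + 2 from rfl, coeff_X_pow_mul, coeff_X_pow_mul, coeff_mk, coeff_mk]
        push_cast; ring
  rw [through, h, coeff_firstReturn_mul]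

theorem coeff_one_through : coeff 1 (through E) = 0 := by
  have h : coeff 0 (d⁄dX ℝ (firstReturn E)) = 0 := by
    simp [firstReturn]
  rw [coeff_zero_eq_constantCoeff_apply] at h
  rw [through, mul_assoc, show (1 : ℕ) = 0 + 1 from rfl, coeff_succ_X_mul,
    coeff_zero_eq_constantCoeff_apply, map_mul, h, zero_mul]

theorem coeff_zero_returns : coeff 0 (returns E) = 1 := by
  rw [returns_eq]; simp [firstReturn]

theorem coeff_one_returns : coeff 1 (returns E) = 0 := by
  rw [returns_eq, map_add, firstReturn, mul_assoc]; simp [coeff_X_pow_mul', coeff_one]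

theorem coeff_returns_add_two (m : ℕ) :
    coeff (m + 2) (returns E) = ∑ l ∈ range (m + 1), E (m - l) * coeff l (returns E) := by
  conv_lhs => rw [returns_eq]
  rw [map_add, coeff_firstReturn_mul]; simp [coeff_one]

theorem coeffNonneg_firstReturn (hE : ∀ s, 0 ≤ E s) : CoeffNonneg (firstReturn E) := by
  rw [firstReturn, pow_two]
  exact (coeffNonneg_X.mul coeffNonneg_X).mul (coeffNonneg_mk hE)

theorem coeffNonneg_returns (hE : ∀ s, 0 ≤ E s) : CoeffNonneg (returns E) := by
  intro k
  induction k using Nat.strong_induction_on with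
  | _ k ih =>
    rcases k with _ | _ | k
    · simp [coeff_zero_returns]
    · simp [coeff_one_returns]
    · rw [coeff_returns_add_two]
      exact Finset.sum_nonneg fun l hl =>
        mul_nonneg (hE _) (ih l (by have := Finset.mem_range.1 hl; omega))

theorem coeffNonneg_through (hE : ∀ s, 0 ≤ E s) : CoeffNonneg (through E) :=
  (coeffNonneg_X.mul (coeffNonneg_firstReturn hE).derivative).mul (coeffNonneg_returns hE)

theorem firstReturn_sub : firstReturn F - firstReturn E = firstReturn (F - E) := by
  ext k
  rw [map_sub, firstReturn, firstReturn, firstReturn, coeff_X_pow_mul', coeff_X_pow_mul',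
    coeff_X_pow_mul']
  split_ifs <;> simp

theorem returns_sub : returns F - returns E = firstReturn (F - E) * returns E * returns F := by
  rw [← firstReturn_sub]
  linear_combination returns E * returns_mul (E := F) - returns F * returns_mul (E := E)

/-- This is the derivative of log((1 - E)/(1 - F)), with E and F standing for the first-return
series. Splitting F' and applying the resolvent identity `returns_sub` leaves only products of
nonnegative series. -/
theorem coeffNonneg_derivative_mul_returns_sub (hE : ∀ s, 0 ≤ E s) (h : ∀ s, E s ≤ F s) :
    CoeffNonneg (d⁄dX ℝ (firstReturn F) * returns F - d⁄dX ℝ (firstReturn E) * returns E) := by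
  have hF : ∀ s, 0 ≤ F s := fun s => (hE s).trans (h s)
  have hd : ∀ s, 0 ≤ (F - E) s := fun s => sub_nonneg.2 (h s)
  have : d⁄dX ℝ (firstReturn F) * returns F - d⁄dX ℝ (firstReturn E) * returns E =
      d⁄dX ℝ (firstReturn (F - E)) * returns F +
        d⁄dX ℝ (firstReturn E) * (firstReturn (F - E) * returns E * returns F) := by
    rw [← returns_sub, ← firstReturn_sub, map_sub]; ring
  rw [this]
  exact ((coeffNonneg_firstReturn hd).derivative.mul (coeffNonneg_returns hF)).add
    ((coeffNonneg_firstReturn hE).derivative.mul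
      (((coeffNonneg_firstReturn hd).mul (coeffNonneg_returns hE)).mul (coeffNonneg_returns hF)))

theorem coeff_through_mono (hE : ∀ s, 0 ≤ E s) (h : ∀ s, E s ≤ F s) (k : ℕ) :
    coeff k (through E) ≤ coeff k (through F) := by
  have := (coeffNonneg_X.mul (coeffNonneg_derivative_mul_returns_sub hE h)) k
  rw [mul_sub, map_sub, ← mul_assoc, ← mul_assoc] at this
  exact sub_nonneg.1 this

theorem derivative_returns :
    d⁄dX ℝ (returns E) = d⁄dX ℝ (firstReturn E) * returns E * returns E := by
  rw [returns, derivative_inv', map_sub, ← map_one (PowerSeries.C (R := ℝ)), derivative_C]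
  ring

/-- A coefficientwise log(1 + y) ≤ y. With y = `firstReturn (F - E) * returns F` one has (1 - E)/(1
- F) = 1 + y for the first-return series, so the left side comes from X (log(1 + y))' and the right
side from X y'; the defect X y (log(1 + y))' is nonnegative. -/
theorem coeff_through_sub_le (hE : ∀ s, 0 ≤ E s) (h : ∀ s, E s ≤ F s) (k : ℕ) :
    coeff k (through F) - coeff k (through E) ≤
      k * coeff k (firstReturn (F - E) * returns F) := by
  have hF : ∀ s, 0 ≤ F s := fun s => (hE s).trans (h s)
  have hd : ∀ s, 0 ≤ (F - E) s := fun s => sub_nonneg.2 (h s)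
  have key : X * d⁄dX ℝ (firstReturn (F - E) * returns F) - (through F - through E) =
      X * (firstReturn (F - E) * returns F) *
        (d⁄dX ℝ (firstReturn F) * returns F - d⁄dX ℝ (firstReturn E) * returns E) := by
    have h1 := returns_sub (E := E) (F := F)
    have h2 : d⁄dX ℝ (firstReturn (F - E)) =
        d⁄dX ℝ (firstReturn F) - d⁄dX ℝ (firstReturn E) := by
      rw [← firstReturn_sub, map_sub]
    rw [Derivation.leibniz, smul_eq_mul, smul_eq_mul, derivative_returns, h2, through, through]
    linear_combination (-X * d⁄dX ℝ (firstReturn E)) * h1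
  have hn := (coeffNonneg_X.mul ((coeffNonneg_firstReturn hd).mul (coeffNonneg_returns hF))).mul
    (coeffNonneg_derivative_mul_returns_sub hE h) k
  rw [← key, map_sub, map_sub] at hn
  have hk : coeff k (X * d⁄dX ℝ (firstReturn (F - E) * returns F)) =
      k * coeff k (firstReturn (F - E) * returns F) := by
    rcases k with _ | k
    · simp
    · rw [coeff_succ_X_mul, coeff_derivative]; push_cast; ring
  rw [hk] at hn
  linarith

end ReturnSeries

/-! ### Closed walks through a bordering index. -/

section ReturnIdentity

variable {V : Type*} [Fintype V] [DecidableEq V]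

/-- `A` is obtained from `C` by bordering it, at the index `w`, with the vector `b`. -/
structure IsBordering (A C : Matrix V V ℝ) (w : V) (b : V → ℝ) : Prop where
  eq : A = C + vecMulVec b (Pi.single w 1) + vecMulVec (Pi.single w 1) b
  col : C *ᵥ Pi.single w 1 = 0
  row : Pi.single w 1 ᵥ* C = 0
  self : b w = 0

variable {A C : Matrix V V ℝ} {w : V} {b : V → ℝ}

theorem IsBordering.mulVec_single (h : IsBordering A C w b) : A *ᵥ Pi.single w 1 = b := by
  have hs := h.self
  rw [h.eq, add_mulVec, add_mulVec, h.col, vecMulVec_mulVec, vecMulVec_mulVec]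
  simp [hs]

theorem IsBordering.single_vecMul (h : IsBordering A C w b) : Pi.single w 1 ᵥ* A = b := by
  have hs := h.self
  rw [h.eq, vecMul_add, vecMul_add, h.row, vecMul_vecMulVec, vecMul_vecMulVec]
  simp [hs]

/-- The number of excursions from the bordering index. -/
def excursion (C : Matrix V V ℝ) (b : V → ℝ) (s : ℕ) : ℝ := b ⬝ᵥ (C ^ s) *ᵥ b

/-- Decomposition at the last visit to w, at time l: what follows avoids w. In the induction, the
last A-step either stays off w or returns to it, closing an excursion. -/
theorem IsBordering.single_pow_mulVec (h : IsBordering A C w b) (j i : ℕ) :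
    (Pi.single w 1 ᵥ* A ^ j) ⬝ᵥ (C ^ i *ᵥ b) =
      ∑ l ∈ range j, (A ^ l) w w * excursion C b (i + (j - 1 - l)) := by
  induction j generalizing i with
  | zero =>
    rcases i with _ | i
    · simp [h.self]
    · rw [pow_zero, vecMul_one, pow_succ', ← mulVec_mulVec, dotProduct_mulVec, h.row]
      simp
  | succ j ih =>
    have hw : (C ^ i *ᵥ b) w = 0 := by
      rcases i with _ | i
      · simp [h.self]
      · have : Pi.single w 1 ⬝ᵥ (C ^ (i + 1) *ᵥ b) = 0 := by
          rw [pow_succ', ← mulVec_mulVec, dotProduct_mulVec, h.row, zero_dotProduct]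
        rwa [single_one_dotProduct] at this
    have e : A *ᵥ (C ^ i *ᵥ b) = C ^ (i + 1) *ᵥ b + excursion C b i • Pi.single w 1 := by
      conv_lhs => rw [h.eq]
      rw [add_mulVec, add_mulVec, vecMulVec_mulVec, vecMulVec_mulVec, mulVec_mulVec, ← pow_succ',
        single_one_dotProduct, hw]
      simp [excursion]
    rw [pow_succ, ← vecMul_vecMul, ← dotProduct_mulVec, e, dotProduct_add, ih, dotProduct_smul,
      Finset.sum_range_succ, dotProduct_single_one]
    congr 1
    · refine Finset.sum_congr rfl fun l hl => ?_
      have := Finset.mem_range.1 hl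
      congr 2; omega
    · simp [mul_comm]

theorem IsBordering.pow_apply_add_two (h : IsBordering A C w b) (m : ℕ) :
    (A ^ (m + 2)) w w = ∑ l ∈ range (m + 1), excursion C b (m - l) * (A ^ l) w w := by
  have h1 := h.single_pow_mulVec (m + 1) 0
  have h2 : (A ^ (m + 2)) w w = (Pi.single w 1 ᵥ* A ^ (m + 1)) ⬝ᵥ (C ^ 0 *ᵥ b) := by
    rw [pow_zero, one_mulVec, ← h.mulVec_single, dotProduct_mulVec, vecMul_vecMul, ← pow_succ]
    simp
  rw [h2, h1]
  refine Finset.sum_congr rfl fun l hl => ?_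
  rw [mul_comm]; congr 2; omega

theorem IsBordering.coeff_returns (h : IsBordering A C w b) (k : ℕ) :
    coeff k (returns (excursion C b)) = (A ^ k) w w := by
  induction k using Nat.strong_induction_on with
  | _ k ih =>
    rcases k with _ | _ | k
    · simp [coeff_zero_returns]
    · have : A w w = 0 := by
        have := congrFun h.mulVec_single w
        simpa [h.self] using this
      simp [coeff_one_returns, this]
    · rw [coeff_returns_add_two, h.pow_apply_add_two]
      exact Finset.sum_congr rfl fun l hl => by
        rw [ih l (by have := Finset.mem_range.1 hl; omega)]

theorem pow_sub_pow_eq_sum {R : Type*} [Ring R] (a c : R) (k : ℕ) :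
    a ^ k - c ^ k = ∑ j ∈ range k, c ^ (k - 1 - j) * (a - c) * a ^ j := by
  induction k with
  | zero => simp
  | succ k ih =>
    rw [Finset.sum_range_succ, show k + 1 - 1 - k = 0 by omega, pow_zero, one_mul]
    have : ∑ j ∈ range k, c ^ (k + 1 - 1 - j) * (a - c) * a ^ j = c * (a ^ k - c ^ k) := by
      rw [ih, Finset.mul_sum]
      refine Finset.sum_congr rfl fun j hj => ?_
      have := Finset.mem_range.1 hj
      rw [show k + 1 - 1 - j = (k - 1 - j) + 1 by omega, pow_succ']
      simp only [mul_assoc]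
    rw [this, pow_succ', pow_succ']
    noncomm_ring

/-- Telescope A^k - C^k and insert the rank-two difference A - C. The half b eᵀ gives the double sum
of last-visit decompositions; the half e bᵀ survives only next to C^0, since C kills e, and gives
(A^k) w w. For k = m + 2 the index l occurs m - l + 1 times in the first and once in the second,
which matches the factor in `coeff_through_add_two`. -/
theorem IsBordering.trace_pow (h : IsBordering A C w b) {k : ℕ} (hk : k ≠ 0) :
    trace (A ^ k) = trace (C ^ k) + coeff k (through (excursion C b)) := by
  have key : trace (A ^ k) - trace (C ^ k) =
      (∑ j ∈ range k, ∑ l ∈ range j, (A ^ l) w w * excursion C b (k - 2 - l)) + (A ^ k) w w := by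
    rw [← trace_sub, pow_sub_pow_eq_sum, trace_sum]
    have hdiff : A - C = vecMulVec b (Pi.single w 1) + vecMulVec (Pi.single w 1) b := by
      rw [h.eq]; abel
    have hterm : ∀ j ∈ range k, trace (C ^ (k - 1 - j) * (A - C) * A ^ j) =
        (∑ l ∈ range j, (A ^ l) w w * excursion C b (k - 2 - l)) +
          if j = k - 1 then (A ^ k) w w else 0 := by
      intro j hj
      have hj := Finset.mem_range.1 hj
      rw [hdiff, mul_add, add_mul, trace_add, mul_vecMulVec, vecMulVec_mul, trace_vecMulVec,
        dotProduct_comm, h.single_pow_mulVec]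
      congr 1
      · refine Finset.sum_congr rfl fun l hl => ?_
        have := Finset.mem_range.1 hl
        congr 2; omega
      · rw [mul_vecMulVec, vecMulVec_mul, trace_vecMulVec]
        split_ifs with hjk
        · subst hjk
          rw [Nat.sub_self, pow_zero, one_mulVec, ← h.single_vecMul, vecMul_vecMul, ← pow_succ',
            show k - 1 + 1 = k by omega]
          simp
        · obtain ⟨i, hi⟩ : ∃ i, k - 1 - j = i + 1 := ⟨k - 2 - j, by omega⟩
          rw [hi, pow_succ, ← mulVec_mulVec, h.col]
          simp
    rw [Finset.sum_congr rfl hterm, Finset.sum_add_distrib]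
    congr 1
    rw [Finset.sum_ite_eq']
    simp; omega
  rcases k with _ | _ | m
  · exact absurd rfl hk
  · rw [coeff_one_through]
    have h0 : (A ^ 1) w w = 0 := by rw [← h.coeff_returns, coeff_one_returns]
    rw [zero_add, h0] at key
    simp at key ⊢
    linarith
  · rw [coeff_through_add_two]
    rw [h.pow_apply_add_two] at key
    have hsum : ∑ j ∈ range (m + 2), ∑ l ∈ range j, (A ^ l) w w * excursion C b (m + 2 - 2 - l) =
        ∑ l ∈ range (m + 1), ((m - l : ℕ) + 1 : ℝ) * ((A ^ l) w w * excursion C b (m - l)) := by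
      have : ∀ n : ℕ, ∀ f : ℕ → ℝ, ∑ j ∈ range (n + 1), ∑ l ∈ range j, f l =
          ∑ l ∈ range n, ((n - 1 - l : ℕ) + 1 : ℝ) * f l := by
        intro n f
        induction n with
        | zero => simp
        | succ n ih =>
          rw [Finset.sum_range_succ, ih, Finset.sum_range_succ, Finset.sum_range_succ _ n,
            ← add_assoc, ← Finset.sum_add_distrib]
          congr 1
          · refine Finset.sum_congr rfl fun l hl => ?_
            have := Finset.mem_range.1 hl
            rw [show n + 1 - 1 - l = (n - 1 - l) + 1 by omega]
            push_cast; ring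
          · simp
      rw [this]
      simp
    rw [hsum, ← Finset.sum_add_distrib] at key
    have : ∑ l ∈ range (m + 1), ((m - l : ℕ) + 2 : ℝ) * excursion C b (m - l) *
        coeff l (returns (excursion C b)) = ∑ l ∈ range (m + 1),
          (((m - l : ℕ) + 1 : ℝ) * ((A ^ l) w w * excursion C b (m - l)) +
            excursion C b (m - l) * (A ^ l) w w) := by
      refine Finset.sum_congr rfl fun l _ => ?_
      rw [h.coeff_returns]; ring
    rw [this]
    linarith

end ReturnIdentity

/-! ### Traces of exponentials and the passage to the line graph. -/

section Estrada

variable {V : Type*} [Fintype V] [DecidableEq V]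

/-- The Estrada index `tr exp A` of a square matrix, as a sum of power traces. -/
noncomputable def estrada (A : Matrix V V ℝ) : ℝ := ∑' k : ℕ, trace (A ^ k) / k.factorial

theorem trace_smul_one_add_pow {A : Matrix V V ℝ} (hA : A.IsHermitian) (c : ℝ) (k : ℕ) :
    trace ((c • (1 : Matrix V V ℝ) + A) ^ k) = ∑ i, (c + hA.eigenvalues i) ^ k := by
  set F := Unitary.conjStarAlgAut ℝ (Matrix V V ℝ) hA.eigenvectorUnitary
  have h1 : c • (1 : Matrix V V ℝ) + A = F (diagonal fun i => c + hA.eigenvalues i) := by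
    have : (diagonal fun i => c + hA.eigenvalues i) =
        c • (1 : Matrix V V ℝ) + diagonal (RCLike.ofReal ∘ hA.eigenvalues) := by
      rw [smul_one_eq_diagonal, diagonal_add]; rfl
    rw [this, map_add, map_smul, map_one]
    conv_lhs => rw [hA.spectral_theorem]
  rw [h1, ← map_pow, diagonal_pow, Unitary.conjStarAlgAut_apply, trace_mul_cycle,
    Unitary.coe_star_mul_self, one_mul, trace_diagonal]
  rfl

theorem hasSum_trace_smul_one_add_pow {A : Matrix V V ℝ} (hA : A.IsHermitian) (c : ℝ) :
    HasSum (fun k : ℕ => trace ((c • (1 : Matrix V V ℝ) + A) ^ k) / k.factorial)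
      (∑ i, Real.exp (c + hA.eigenvalues i)) := by
  have : ∀ i ∈ (univ : Finset V), HasSum
      (fun k : ℕ => (c + hA.eigenvalues i) ^ k / k.factorial)
      (Real.exp (c + hA.eigenvalues i)) := fun i _ => by
    rw [Real.exp_eq_exp_ℝ]; exact by
      simpa [div_eq_inv_mul] using NormedSpace.exp_series_hasSum_exp' (𝕂 := ℝ) (c + hA.eigenvalues i)
  convert hasSum_sum this using 2 with k
  rw [trace_smul_one_add_pow hA, Finset.sum_div]

theorem hasSum_exp_eigenvalues {A : Matrix V V ℝ} (hA : A.IsHermitian) :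
    HasSum (fun k : ℕ => trace (A ^ k) / k.factorial) (∑ i, Real.exp (hA.eigenvalues i)) := by
  simpa using hasSum_trace_smul_one_add_pow hA 0

theorem hasSum_estrada {A : Matrix V V ℝ} (hA : A.IsHermitian) :
    HasSum (fun k : ℕ => trace (A ^ k) / k.factorial) (estrada A) :=
  (hasSum_exp_eigenvalues hA).summable.hasSum

/-- M Mᵀ and Mᵀ M have equal power traces, including k = 0 because M is square; the shift by 2I
multiplies every exponential by e². -/
theorem SLEE_eq_exp_two_mul_estrada (G : SimpleGraph V) [DecidableRel G.Adj]
    {M A : Matrix V V ℝ} (hQ : G.signlessLapMatrix = M * Mᵀ)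
    (hA : Mᵀ * M = (2 : ℝ) • (1 : Matrix V V ℝ) + A) (hH : A.IsHermitian) :
    G.SLEE = Real.exp 2 * estrada A := by
  have h1 := hasSum_exp_eigenvalues G.isHermitian_signlessLapMatrix
  have h2 := hasSum_trace_smul_one_add_pow hH 2
  have h3 : (fun k : ℕ => trace (G.signlessLapMatrix ^ k) / (k.factorial : ℝ)) =
      fun k : ℕ => trace (((2 : ℝ) • (1 : Matrix V V ℝ) + A) ^ k) / k.factorial := by
    funext k
    rw [hQ, ← hA]
    rcases k with _ | k
    · simp
    · rw [pow_succ, ← mul_assoc, mul_pow_mul, mul_assoc, trace_mul_comm, mul_assoc, ← pow_succ]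
  rw [h3] at h1
  rw [SimpleGraph.SLEE, h1.unique h2, (hasSum_estrada hH).unique (hasSum_exp_eigenvalues hH),
    Finset.mul_sum]
  exact Finset.sum_congr rfl fun i _ => Real.exp_add _ _

end Estrada

/-! ### Graphs whose edges are the pairs {v, φ v}. -/

section Functional

variable {V : Type*} [Fintype V] [DecidableEq V]

/-- The edges of `G` are the pairs `{v, φ v}`, which are distinct for distinct `v`. -/
structure IsFunctional (G : SimpleGraph V) (φ : V → V) : Prop where
  adj : ∀ u v, G.Adj u v ↔ φ u = v ∨ φ v = u
  sq_ne : ∀ v, φ (φ v) ≠ v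

theorem IsFunctional.ne {G : SimpleGraph V} {φ : V → V} (h : IsFunctional G φ) (v : V) :
    φ v ≠ v := fun e => G.irrefl ((h.adj v v).2 (Or.inl e))

/-- The adjacency matrix of the line graph of the graph with edges `{v, φ v}`. -/
def lineMatrix (φ : V → V) : Matrix V V ℝ := Matrix.of fun e f =>
  if e = f then 0 else
    (if φ e = f then 1 else 0) + (if φ f = e then 1 else 0) + (if φ e = φ f then 1 else 0)

theorem isHermitian_lineMatrix (φ : V → V) : (lineMatrix φ).IsHermitian := by
  ext e f
  simp only [lineMatrix, conjTranspose_apply, of_apply, star_trivial]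
  rcases eq_or_ne e f with rfl | hne
  · simp
  · rw [if_neg hne, if_neg hne.symm, add_comm (ite (φ f = e) _ _)]
    simp only [eq_comm]

theorem lineMatrix_nonneg (φ : V → V) (e f : V) : 0 ≤ lineMatrix φ e f := by
  simp only [lineMatrix, of_apply]; split_ifs <;> norm_num

theorem IsFunctional.SLEE_eq {G : SimpleGraph V} [DecidableRel G.Adj] {φ : V → V}
    (h : IsFunctional G φ) : G.SLEE = Real.exp 2 * estrada (lineMatrix φ) := by
  -- The incidence matrix, with column e standing for the edge {e, φ e}.
  set M : Matrix V V ℝ := Matrix.of fun v e =>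
    (if v = e then 1 else 0) + (if v = φ e then 1 else 0) with hM
  refine SLEE_eq_exp_two_mul_estrada G (M := M) ?_ ?_ (isHermitian_lineMatrix φ)
  · ext u v
    have hadj : ∀ u v, (if G.Adj u v then (1 : ℝ) else 0) =
        (if φ u = v then 1 else 0) + (if φ v = u then 1 else 0) := by
      intro u v
      by_cases h1 : φ u = v <;> by_cases h2 : φ v = u
      · exact absurd (h1 ▸ h2) (h.sq_ne u)
      all_goals simp [h.adj, h1, h2]
    have hdeg : (G.degree u : ℝ) = 1 + ∑ v, if φ v = u then (1 : ℝ) else 0 := by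
      rw [SimpleGraph.degree_eq_sum_if_adj]
      simp only [hadj, Finset.sum_add_distrib]
      simp
    have h1 : ∀ (u : V) (f : V → ℝ), ∑ e, (if u = e then 1 else 0) * f e = f u := by simp
    have h2 : ∀ (u : V) (f : V → ℝ), ∑ e, f e * (if u = e then 1 else 0) = f u := by simp
    simp only [SimpleGraph.signlessLapMatrix, SimpleGraph.degMatrix, Matrix.add_apply,
      SimpleGraph.adjMatrix_apply, hadj, mul_apply, transpose_apply, hM, of_apply, add_mul, mul_add,
      Finset.sum_add_distrib, diagonal_apply, h1, h2]
    simp only [@eq_comm _ _ (φ _)] at *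
    rcases eq_or_ne u v with rfl | hne
    · simp [hdeg, h.ne, ← ite_and]
    · have : ∀ e, (if φ e = u then (1 : ℝ) else 0) * (if φ e = v then 1 else 0) = 0 := by
        intro e
        split_ifs with h1 h2 <;> simp
        exact hne (h1.symm.trans h2)
      simp only [this, if_neg hne, if_neg hne.symm, Finset.sum_const_zero]
      ring
  · ext e f
    have h1 : ∀ (u : V) (f : V → ℝ), ∑ e, (if e = u then 1 else 0) * f e = f u := by simp
    simp only [mul_apply, transpose_apply, hM, of_apply, add_mul, mul_add,
      Finset.sum_add_distrib, lineMatrix, Matrix.add_apply, Matrix.smul_apply, one_apply, h1]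
    rcases eq_or_ne e f with rfl | hne
    · simp [h.ne, (h.ne _).symm]; norm_num
    · simp only [if_neg hne, @eq_comm _ e (φ _), smul_eq_mul]
      ring

end Functional

/-! ### Walks on the half-line and on the line. -/

section Catalan

/-- The number of walks of length `s` from `0` to `i` on the half-line `ℕ`. -/
def ballot : ℕ → ℕ → ℕ
  | 0, 0 => 1
  | 0, _ + 1 => 0
  | s + 1, 0 => ballot s 1
  | s + 1, i + 1 => ballot s i + ballot s (i + 2)

theorem ballot_eq_zero {s i : ℕ} (h : s < i) : ballot s i = 0 := by
  induction s generalizing i with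
  | zero =>
    obtain ⟨i, rfl⟩ : ∃ j, i = j + 1 := ⟨i - 1, by omega⟩
    rfl
  | succ s ih =>
    obtain ⟨i, rfl⟩ : ∃ j, i = j + 1 := ⟨i - 1, by omega⟩
    rw [ballot, ih (by omega), ih (by omega)]

theorem ballot_self (s : ℕ) : ballot s s = 1 := by
  induction s with
  | zero => rfl
  | succ s ih => rw [ballot, ih, ballot_eq_zero (by omega)]

/-- The reflection principle, with the subtraction moved to the other side. -/
theorem ballot_add_choose (s i j : ℕ) (h : s = i + 2 * (j + 1)) :
    ballot s i + s.choose j = s.choose (j + 1) := by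
  induction s generalizing i j with
  | zero => omega
  | succ s ih =>
    rcases i with _ | i
    · rw [ballot]
      rcases j with _ | j
      · obtain rfl : s = 1 := by omega
        simp [ballot_self]
      · have h1 := ih 1 j (by omega)
        have h2 : s.choose (j + 1 + 1) = s.choose (j + 1) :=
          Nat.choose_symm_of_eq_add (by omega)
        rw [Nat.choose_succ_succ', Nat.choose_succ_succ', h2]
        omega
    · rw [ballot]
      rcases j with _ | j
      · have h1 := ih i 0 (by omega)
        obtain rfl : s = i + 2 := by omega
        rw [ballot_self] at *
        rw [Nat.choose_succ_succ']
        simp at *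
        omega
      · have h1 := ih i (j + 1) (by omega)
        have h2 := ih (i + 2) j (by omega)
        rw [Nat.choose_succ_succ', Nat.choose_succ_succ']
        omega

theorem ballot_two_mul_zero (a : ℕ) : ballot (2 * a) 0 = catalan a := by
  rcases a with _ | a
  · simp [ballot]
  · have h1 := ballot_add_choose (2 * (a + 1)) 0 a (by omega)
    have h2 := succ_mul_catalan_eq_centralBinom (a + 1)
    rw [Nat.centralBinom] at h2
    have h3 := Nat.choose_succ_right_eq (2 * (a + 1)) a
    rw [show 2 * (a + 1) - a = a + 2 by omega] at h3
    refine Nat.eq_of_mul_eq_mul_left (show 0 < a + 1 + 1 by omega) ?_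
    rw [h2]
    nlinarith

theorem sum_range_mul_ballot (g : ℕ → ℝ) (s : ℕ) :
    ∑ i ∈ range (s + 2), g i * ballot (s + 1) i =
      ∑ i ∈ range (s + 1), ballot s i * (g (i + 1) + if i = 0 then 0 else g (i - 1)) := by
  have h1 : ∑ i ∈ range (s + 1), (ballot s i : ℝ) * (if i = 0 then 0 else g (i - 1)) =
      ∑ i ∈ range (s + 2), g i * ballot s (i + 1) := by
    rw [Finset.sum_range_succ', Finset.sum_range_succ _ (s + 1), Finset.sum_range_succ _ s,
      ballot_eq_zero (show s < s + 1 by omega), ballot_eq_zero (show s < s + 1 + 1 by omega)]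
    simp [mul_comm]
  simp only [mul_add, Finset.sum_add_distrib, h1]
  rw [Finset.sum_range_succ', Finset.sum_range_succ' _ (s + 1), ← add_assoc,
    ← Finset.sum_add_distrib]
  congr 1
  exact Finset.sum_congr rfl fun i _ => by rw [ballot]; push_cast; ring

/-- The Catalan numbers, as excursion numbers of the end of a half-line. -/
def catalanExcursion (s : ℕ) : ℝ := if Even s then catalan (s / 2) else 0

theorem catalanExcursion_nonneg (s : ℕ) : 0 ≤ catalanExcursion s := by
  rw [catalanExcursion]; split_ifs <;> positivity

theorem catalanExcursion_two_mul (a : ℕ) : catalanExcursion (2 * a) = catalan a := by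
  simp [catalanExcursion]

theorem catalanExcursion_le_ballot (s : ℕ) : catalanExcursion s ≤ ballot s 0 := by
  rw [catalanExcursion]
  split_ifs with h
  · obtain ⟨a, rfl⟩ := h
    rw [← two_mul, ballot_two_mul_zero, Nat.mul_div_cancel_left _ two_pos]
  · positivity

theorem sum_range_two_mul_le {f : ℕ → ℝ} (hf : ∀ i, 0 ≤ f i) (j : ℕ) :
    ∑ c ∈ range (j + 1), f (2 * c) ≤ ∑ l ∈ range (2 * j + 1), f l := by
  rw [← Finset.sum_image (f := f) (g := fun c => 2 * c) (fun a _ b _ h => by simpa using h)]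
  refine Finset.sum_le_sum_of_subset_of_nonneg ?_ fun i _ _ => hf i
  intro x hx
  obtain ⟨c, hc, rfl⟩ := Finset.mem_image.1 hx
  have := Finset.mem_range.1 hc
  exact Finset.mem_range.2 (by omega)

theorem catalan_succ_eq_sum_range (j : ℕ) :
    catalan (j + 1) = ∑ c ∈ range (j + 1), catalan (j - c) * catalan c := by
  rw [catalan_succ, Finset.sum_range]
  exact Finset.sum_congr rfl fun i _ => mul_comm _ _

/-- Returns to the end of a half-line obey the Catalan recursion. Discarding the odd terms of the
convolution leaves an inequality, which suffices. -/
theorem catalan_le_coeff_returns (b : ℕ) :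
    (catalan b : ℝ) ≤ PowerSeries.coeff (2 * b) (returns catalanExcursion) := by
  induction b using Nat.strong_induction_on with
  | _ b ih =>
    rcases b with _ | j
    · simp [coeff_zero_returns]
    · rw [show 2 * (j + 1) = 2 * j + 2 by ring, coeff_returns_add_two, catalan_succ_eq_sum_range]
      refine le_trans ?_ (sum_range_two_mul_le (fun l => mul_nonneg (catalanExcursion_nonneg _)
        (coeffNonneg_returns catalanExcursion_nonneg l)) j)
      push_cast
      refine Finset.sum_le_sum fun c hc => ?_
      have := Finset.mem_range.1 hc
      rw [← Nat.mul_sub, catalanExcursion_two_mul]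
      exact mul_le_mul_of_nonneg_left (ih c (by omega)) (by positivity)

/-- The number of closed walks of length `k` on the line `ℤ` with a given starting point. -/
def centralWalks (k : ℕ) : ℝ :=
  ∑ p ∈ antidiagonal k, if p.1 = p.2 then (k.choose p.1 : ℝ) else 0

theorem centralWalks_two_mul (j : ℕ) : centralWalks (2 * j) = j.centralBinom := by
  rw [centralWalks, Finset.sum_eq_single (j, j)]
  · simp [Nat.centralBinom]
  · rintro ⟨a, b⟩ hp hne
    have := HasAntidiagonal.mem_antidiagonal.1 hp
    rw [if_neg]
    intro h
    simp only at h this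
    exact hne (by ext <;> simp <;> omega)
  · intro h
    exact absurd (HasAntidiagonal.mem_antidiagonal.2 (two_mul j).symm) h

theorem centralWalks_of_not_even {k : ℕ} (h : ¬ Even k) : centralWalks k = 0 := by
  refine Finset.sum_eq_zero fun p hp => if_neg fun e => h ?_
  have := HasAntidiagonal.mem_antidiagonal.1 hp
  exact ⟨p.1, by omega⟩

/-- Prolonging a half-line by one vertex at its end costs as many closed walks as a vertex of ℤ has.
-/
theorem centralWalks_le_coeff_through {k : ℕ} (hk : k ≠ 0) :
    centralWalks k ≤ PowerSeries.coeff k (through catalanExcursion) := by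
  by_cases h : Even k
  · obtain ⟨j, rfl⟩ : ∃ j, k = 2 * j + 2 := by
      obtain ⟨a, rfl⟩ := h
      exact ⟨a - 1, by omega⟩
    rw [show 2 * j + 2 = 2 * (j + 1) by ring, centralWalks_two_mul,
      show 2 * (j + 1) = 2 * j + 2 by ring, coeff_through_add_two]
    -- Averaging with the reflected sum c ↦ j - c makes the weight the constant j + 2, and (j + 2)
    -- `catalan (j + 1)` is the central binomial coefficient.
    have hsym : ((j + 1).centralBinom : ℝ) =
        ∑ c ∈ range (j + 1), (2 * (j - c : ℕ) + 2 : ℝ) * catalan (j - c) * catalan c := by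
      have h1 : ∑ c ∈ range (j + 1), (2 * (j - c : ℕ) + 2 : ℝ) * catalan (j - c) * catalan c =
          ∑ c ∈ range (j + 1), (2 * c + 2 : ℝ) * catalan c * catalan (j - c) := by
        rw [← Finset.sum_range_reflect]
        refine Finset.sum_congr rfl fun c hc => ?_
        have := Finset.mem_range.1 hc
        rw [show j - (j + 1 - 1 - c) = c by omega, show j + 1 - 1 - c = j - c by omega]
      have h2 : ∑ c ∈ range (j + 1), (2 * (j - c : ℕ) + 2 : ℝ) * catalan (j - c) * catalan c +
          ∑ c ∈ range (j + 1), (2 * c + 2 : ℝ) * catalan c * catalan (j - c) =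
            2 * (j + 1).centralBinom := by
        rw [← succ_mul_catalan_eq_centralBinom, catalan_succ_eq_sum_range,
          ← Finset.sum_add_distrib]
        push_cast
        rw [Finset.mul_sum, Finset.mul_sum]
        refine Finset.sum_congr rfl fun c hc => ?_
        have := Finset.mem_range.1 hc
        rw [Nat.cast_sub (by omega)]
        ring
      linarith
    rw [hsym]
    refine le_trans ?_ (sum_range_two_mul_le (fun l => mul_nonneg (mul_nonneg (by positivity)
      (catalanExcursion_nonneg _)) (coeffNonneg_returns catalanExcursion_nonneg l)) j)
    refine Finset.sum_le_sum fun c hc => ?_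
    rw [← Nat.mul_sub, catalanExcursion_two_mul]
    push_cast
    exact mul_le_mul_of_nonneg_left (catalan_le_coeff_returns c) (by positivity)
  · rw [centralWalks_of_not_even h]
    exact coeffNonneg_through catalanExcursion_nonneg k

end Catalan

/-! ### Peeling off the vertices outside the cycle. -/

section Restrict

variable {V : Type*} [Fintype V] [DecidableEq V]

theorem pow_apply_nonneg {A : Matrix V V ℝ} (hA : ∀ i j, 0 ≤ A i j) (k : ℕ) (i j : V) :
    0 ≤ (A ^ k) i j := by
  induction k generalizing i j with
  | zero => rw [pow_zero, one_apply]; split_ifs <;> norm_num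
  | succ k ih =>
    rw [pow_succ, mul_apply]
    exact Finset.sum_nonneg fun l _ => mul_nonneg (ih i l) (hA l j)

/-- The map p sends walks on the half-line to walks for C. It may wrap around a cycle, but the two
neighbours of an index have different images, so distinct walks from 0 stay distinct. -/
theorem sum_ballot_le_pow_apply {C : Matrix V V ℝ} (hC : ∀ i j, 0 ≤ C i j) (hs : C.IsSymm)
    {p : ℕ → V} (hp : ∀ i, 1 ≤ C (p i) (p (i + 1))) (hne : ∀ i, p (i + 2) ≠ p i) (s : ℕ) (v : V) :
    ∑ i ∈ range (s + 1), (if p i = v then (1 : ℝ) else 0) * ballot s i ≤ (C ^ s) (p 0) v := by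
  induction s generalizing v with
  | zero => simp [ballot, one_apply]
  | succ s ih =>
    rw [sum_range_mul_ballot, pow_succ, mul_apply]
    calc _ ≤ ∑ i ∈ range (s + 1), (ballot s i : ℝ) * C (p i) v := by
          refine Finset.sum_le_sum fun i _ => mul_le_mul_of_nonneg_left ?_ (by positivity)
          rcases i with _ | i
          · simp only [if_true, add_zero, zero_add]
            split_ifs with h
            · rw [← h]; exact hp 0
            · exact hC _ _
          · rw [if_neg (Nat.succ_ne_zero i), Nat.add_sub_cancel]
            by_cases h1 : p (i + 2) = v
            · rw [if_pos h1, if_neg (fun h => hne i (h1.trans h.symm)), add_zero, ← h1]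
              exact hp (i + 1)
            · rw [if_neg h1, zero_add]
              split_ifs with h
              · rw [← h, hs.apply]; exact hp i
              · exact hC _ _
      _ = ∑ u, (∑ i ∈ range (s + 1), (if p i = u then (1 : ℝ) else 0) * ballot s i) * C u v := by
          simp only [Finset.sum_mul]
          rw [Finset.sum_comm]
          refine Finset.sum_congr rfl fun i _ => ?_
          simp
      _ ≤ _ := Finset.sum_le_sum fun u _ => mul_le_mul_of_nonneg_right (ih u) (hC _ _)

theorem catalanExcursion_le_excursion {C : Matrix V V ℝ} {b : V → ℝ} (hC : ∀ i j, 0 ≤ C i j)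
    (hs : C.IsSymm) (hb : ∀ i, 0 ≤ b i) {p : ℕ → V} (hp : ∀ i, 1 ≤ C (p i) (p (i + 1)))
    (hne : ∀ i, p (i + 2) ≠ p i) (h0 : 1 ≤ b (p 0)) (s : ℕ) :
    catalanExcursion s ≤ excursion C b s := by
  have h1 : (ballot s 0 : ℝ) ≤ (C ^ s) (p 0) (p 0) := by
    refine le_trans ?_ (sum_ballot_le_pow_apply hC hs hp hne s (p 0))
    refine le_trans ?_ (Finset.single_le_sum (fun i _ => ?_) (Finset.mem_range.2 s.succ_pos))
    · simp
    · split_ifs <;> simp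
  have hnn := pow_apply_nonneg hC s
  have h2 : (C ^ s) (p 0) (p 0) ≤ (C ^ s *ᵥ b) (p 0) := by
    refine le_trans (le_mul_of_one_le_right (hnn _ _) h0) ?_
    exact Finset.single_le_sum (f := fun j => (C ^ s) (p 0) j * b j)
      (fun i _ => mul_nonneg (hnn _ _) (hb i)) (mem_univ (p 0))
  have h4 : ∀ i, 0 ≤ (C ^ s *ᵥ b) i := fun i =>
    Finset.sum_nonneg fun j _ => mul_nonneg (hnn _ _) (hb j)
  have h3 : (C ^ s *ᵥ b) (p 0) ≤ excursion C b s := by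
    refine le_trans (le_mul_of_one_le_left (h4 _) h0) ?_
    exact Finset.single_le_sum (f := fun j => b j * (C ^ s *ᵥ b) j)
      (fun i _ => mul_nonneg (hb i) (h4 i)) (mem_univ (p 0))
  exact (catalanExcursion_le_ballot s).trans (h1.trans (h2.trans h3))

/-- The matrix `A` with all entries outside `S × S` replaced by zero. -/
def restrict (A : Matrix V V ℝ) (S : Finset V) : Matrix V V ℝ :=
  Matrix.of fun i j => if i ∈ S ∧ j ∈ S then A i j else 0

theorem restrict_univ (A : Matrix V V ℝ) : restrict A univ = A := by
  ext i j; simp [restrict]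

theorem restrict_nonneg {A : Matrix V V ℝ} (hA : ∀ i j, 0 ≤ A i j) (S : Finset V) (i j : V) :
    0 ≤ restrict A S i j := by
  simp only [restrict, of_apply]; split_ifs
  · exact hA i j
  · exact le_rfl

theorem restrict_isSymm {A : Matrix V V ℝ} (hA : A.IsSymm) (S : Finset V) :
    (restrict A S).IsSymm := by
  ext i j
  simp only [restrict, transpose_apply, of_apply, hA.apply i j, and_comm]

theorem isBordering_restrict {A : Matrix V V ℝ} (hA : A.IsSymm) {S : Finset V} {w : V}
    (hw : w ∉ S) (h0 : A w w = 0) :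
    IsBordering (restrict A (insert w S)) (restrict A S) w
      (fun i => if i ∈ S then A w i else 0) where
  eq := by
    ext i j
    simp only [restrict, Matrix.add_apply, of_apply, vecMulVec_apply, Finset.mem_insert,
      Pi.single_apply]
    by_cases hi : i = w <;> by_cases hj : j = w
    · subst hi; subst hj; simp [h0, hw]
    · subst hi; simp [hw, hj]
    · subst hj; simp [hw, hi, hA.apply]
    · simp [hi, hj]
  col := by
    ext i; simp [restrict, hw]
  row := by
    ext i; simp [restrict, hw]
  self := by simp [hw]

/-- Peel T down to K one vertex at a time; each w removed starts a φ-orbit inside the remaining set,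
hence has at least Catalan many excursions. -/
theorem trace_pow_restrict_add_le {A : Matrix V V ℝ} (hA : A.IsSymm) (hnn : ∀ i j, 0 ≤ A i j)
    (hdiag : ∀ i, A i i = 0) {φ : V → V} (hφ : ∀ v, 1 ≤ A v (φ v)) (hsq : ∀ v, φ (φ v) ≠ v)
    {K : Finset V} (hK : ∀ v ∈ K, φ v ∈ K) {d : V → ℕ} (hd : ∀ v ∉ K, d (φ v) < d v)
    {k : ℕ} (hk : k ≠ 0) (n : ℕ) (T : Finset V) (hKT : K ⊆ T) (hT : ∀ v ∈ T, φ v ∈ T)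
    (hn : #T = #K + n) :
    trace (restrict A K ^ k) + n * centralWalks k ≤ trace (restrict A T ^ k) := by
  induction n generalizing T with
  | zero =>
    rw [← Finset.eq_of_subset_of_card_le hKT hn.le]; simp
  | succ n ih =>
    -- Since d drops along φ outside K, no vertex of T maps to a w of maximal d, so `T.erase w` is
    -- still closed under φ.
    obtain ⟨w, hw, hmax⟩ := Finset.exists_max_image (T \ K) d (by
      rw [← Finset.card_pos, Finset.card_sdiff_of_subset hKT]; omega)
    obtain ⟨hwT, hwK⟩ := Finset.mem_sdiff.1 hw
    have hTe : ∀ v ∈ T.erase w, φ v ∈ T.erase w := by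
      intro v hv
      have hvT := Finset.mem_of_mem_erase hv
      refine Finset.mem_erase.2 ⟨fun e => ?_, hT v hvT⟩
      have hvK : v ∉ K := fun h => hwK (e ▸ hK v h)
      have h1 := hd v hvK
      have h2 := hmax v (Finset.mem_sdiff.2 ⟨hvT, hvK⟩)
      rw [e] at h1
      omega
    have hφw : φ w ∈ T.erase w := Finset.mem_erase.2
      ⟨fun e => hsq w (by rw [e, e]), hT w hwT⟩
    have ih' := ih (T.erase w) (fun v hv => Finset.mem_erase.2 ⟨fun e => hwK (e ▸ hv), hKT hv⟩) hTe
      (by rw [Finset.card_erase_of_mem hwT]; omega)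
    have hB := isBordering_restrict hA (Finset.notMem_erase w T) (hdiag w)
    rw [Finset.insert_erase hwT] at hB
    rw [hB.trace_pow hk]
    have hpm : ∀ i, φ^[i] (φ w) ∈ T.erase w := fun i => by
      induction i with
      | zero => exact hφw
      | succ i ih => rw [Function.iterate_succ_apply']; exact hTe _ ih
    have hcat : ∀ s, catalanExcursion s ≤ excursion (restrict A (T.erase w))
        (fun i => if i ∈ T.erase w then A w i else 0) s := by
      refine catalanExcursion_le_excursion (restrict_nonneg hnn _) (restrict_isSymm hA _)
        (fun i => ?_) (p := fun i => φ^[i] (φ w)) (fun i => ?_) (fun i => ?_) ?_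
      · split_ifs
        · exact hnn _ _
        · exact le_rfl
      · simp only [restrict, of_apply]
        rw [if_pos ⟨hpm i, hpm (i + 1)⟩, Function.iterate_succ_apply']
        exact hφ _
      · simp only [Function.iterate_succ_apply']
        exact hsq _
      · change 1 ≤ if φ w ∈ T.erase w then A w (φ w) else 0
        rw [if_pos hφw]
        exact hφ w
    have := (centralWalks_le_coeff_through hk).trans
      (coeff_through_mono catalanExcursion_nonneg hcat k)
    push_cast
    linarith

end Restrict

/-! ### Monotonicity and invariance of power traces under embeddings. -/

section Transfer

variable {V W : Type*} [Fintype V] [DecidableEq V] [Fintype W] [DecidableEq W]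

theorem pow_apply_le_pow_apply {H : Matrix V V ℝ} {A : Matrix W W ℝ} (hH : ∀ i j, 0 ≤ H i j)
    (hA : ∀ i j, 0 ≤ A i j) {f : V → W} (hf : f.Injective) (h : ∀ i j, H i j ≤ A (f i) (f j))
    (k : ℕ) (i j : V) : (H ^ k) i j ≤ (A ^ k) (f i) (f j) := by
  induction k generalizing i j with
  | zero => simp [one_apply, hf.eq_iff]
  | succ k ih =>
    rw [pow_succ, pow_succ, mul_apply, mul_apply]
    calc _ ≤ ∑ l, (A ^ k) (f i) (f l) * A (f l) (f j) := Finset.sum_le_sum fun l _ =>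
          mul_le_mul (ih i l) (h l j) (hH _ _) (pow_apply_nonneg hA _ _ _)
      _ = ∑ l ∈ univ.image f, (A ^ k) (f i) l * A l (f j) :=
          (Finset.sum_image (f := fun l => (A ^ k) (f i) l * A l (f j)) hf.injOn).symm
      _ ≤ _ := Finset.sum_le_sum_of_subset_of_nonneg (Finset.subset_univ _) fun l _ _ =>
          mul_nonneg (pow_apply_nonneg hA _ _ _) (hA _ _)

theorem trace_pow_le_trace_pow {H : Matrix V V ℝ} {A : Matrix W W ℝ} (hH : ∀ i j, 0 ≤ H i j)
    (hA : ∀ i j, 0 ≤ A i j) {f : V → W} (hf : f.Injective) (h : ∀ i j, H i j ≤ A (f i) (f j))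
    (k : ℕ) : trace (H ^ k) ≤ trace (A ^ k) := by
  calc _ ≤ ∑ l, (A ^ k) (f l) (f l) := Finset.sum_le_sum fun l _ =>
        pow_apply_le_pow_apply hH hA hf h k l l
    _ = ∑ l ∈ univ.image f, (A ^ k) l l :=
        (Finset.sum_image (f := fun l => (A ^ k) l l) hf.injOn).symm
    _ ≤ _ := Finset.sum_le_sum_of_subset_of_nonneg (Finset.subset_univ _) fun l _ _ =>
        pow_apply_nonneg hA _ _ _

theorem lineMatrix_apply_of_semiconj {φ : V → V} {ψ : W → W} {f : V → W} (hf : f.Injective)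
    (h : ∀ v, ψ (f v) = f (φ v)) (i j : V) : lineMatrix ψ (f i) (f j) = lineMatrix φ i j := by
  simp [lineMatrix, h, hf.eq_iff]

theorem estrada_lineMatrix_congr {φ : V → V} {ψ : W → W} (f : V ≃ W)
    (h : ∀ v, ψ (f v) = f (φ v)) : estrada (lineMatrix φ) = estrada (lineMatrix ψ) := by
  refine tsum_congr fun k => ?_
  congr 1
  refine le_antisymm ?_ ?_
  · exact trace_pow_le_trace_pow (lineMatrix_nonneg _) (lineMatrix_nonneg _) f.injective
      (fun i j => (lineMatrix_apply_of_semiconj f.injective h i j).ge) k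
  · exact trace_pow_le_trace_pow (lineMatrix_nonneg _) (lineMatrix_nonneg _) f.symm.injective
      (fun i j => by
        rw [← lineMatrix_apply_of_semiconj f.injective h (f.symm i), f.apply_symm_apply,
          f.apply_symm_apply]) k

end Transfer

/-! ### The cycle with a pendant vertex, via walks on ℤ. -/

section Model

/-- The function whose graph is the cycle of length `N` with a pendant vertex. -/
def pendantMap (N : ℕ) : Option (ZMod N) → Option (ZMod N)
  | some i => some (i + 1)
  | none => some 0

variable {V : Type*} [Fintype V] [DecidableEq V]

theorem trace_pow_lineMatrix_ge {φ : V → V} (hsq : ∀ v, φ (φ v) ≠ v) (hne : ∀ v, φ v ≠ v)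
    {N : ℕ} [NeZero N] {f : Option (ZMod N) → V} (hf : f.Injective)
    (h : ∀ v, φ (f v) = f (pendantMap N v)) {d : V → ℕ} (hd : ∀ v ∉ Set.range f, d (φ v) < d v)
    {n : ℕ} (hn : Fintype.card V = N + 1 + n) (k : ℕ) :
    trace (lineMatrix (pendantMap N) ^ k) + n * centralWalks k ≤ trace (lineMatrix φ ^ k) := by
  rcases eq_or_ne k 0 with rfl | hk
  · have h0 := centralWalks_two_mul 0
    simp only [mul_zero, Nat.centralBinom_zero] at h0
    simp [h0, hn, ZMod.card]
  · have hcard : #(univ.image f) = N + 1 := by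
      rw [Finset.card_image_of_injective _ hf]; simp [ZMod.card]
    have h1 := trace_pow_restrict_add_le (A := lineMatrix φ) (by
        simpa using isHermitian_lineMatrix φ)
      (lineMatrix_nonneg φ) (fun i => by simp [lineMatrix]) (φ := φ) (fun v => by
        simp only [lineMatrix, of_apply, if_neg (hne v).symm, if_true]
        split_ifs <;> norm_num) hsq (K := univ.image f) (by
        intro v hv
        obtain ⟨i, -, rfl⟩ := Finset.mem_image.1 hv
        rw [h]
        exact Finset.mem_image_of_mem _ (mem_univ _)) (d := d) (fun v hv => hd v (by
          simpa using hv)) hk n univ (Finset.subset_univ _) (fun _ _ => mem_univ _) (by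
        rw [hcard, Finset.card_univ, hn])
    rw [restrict_univ] at h1
    refine le_trans (add_le_add_left ?_ _) h1
    refine trace_pow_le_trace_pow (lineMatrix_nonneg _) (restrict_nonneg (lineMatrix_nonneg _) _)
      hf (fun i j => ?_) k
    simp [restrict, lineMatrix_apply_of_semiconj hf h]

/-- Walks of length `s` on the line, counted with a weight that depends on the numbers of
steps to the right and to the left. -/
def walkWeights (θ : ℕ × ℕ → ℝ) (s : ℕ) : ℝ := ∑ p ∈ antidiagonal s, s.choose p.1 * θ p

theorem walkWeights_mono {θ η : ℕ × ℕ → ℝ} (h : ∀ p, θ p ≤ η p) (s : ℕ) :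
    walkWeights θ s ≤ walkWeights η s :=
  Finset.sum_le_sum fun p _ => mul_le_mul_of_nonneg_left (h p) (by positivity)

theorem walkWeights_nonneg {θ : ℕ × ℕ → ℝ} (h : ∀ p, 0 ≤ θ p) (s : ℕ) : 0 ≤ walkWeights θ s :=
  Finset.sum_nonneg fun p _ => mul_nonneg (by positivity) (h p)

/-- The indicator of the walks that are closed on the line. -/
def lineWeight (p : ℕ × ℕ) : ℝ := if p.1 = p.2 then 1 else 0

/-- The indicator of the walks that are closed on the cycle of length `N`. -/
def cycleWeight (N : ℕ) (p : ℕ × ℕ) : ℝ := if (p.1 : ZMod N) = p.2 then 1 else 0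

theorem walkWeights_lineWeight (s : ℕ) : walkWeights lineWeight s = centralWalks s := by
  simp [walkWeights, lineWeight, centralWalks]

/-- The number of excursions of the pendant edge to the cycle of length `N` with given steps. -/
def excursionWeight (N : ℕ) (p : ℕ × ℕ) : ℝ :=
  2 * (if (p.1 : ZMod N) = p.2 then 1 else 0) + (if (p.1 + 1 : ZMod N) = p.2 then 1 else 0) +
    (if (p.1 : ZMod N) = p.2 + 1 then 1 else 0)

/-- The number of excursions of the pendant edge to the line with given steps. -/
def lineExcursionWeight (p : ℕ × ℕ) : ℝ :=
  2 * (if p.1 = p.2 then 1 else 0) + (if p.1 + 1 = p.2 then 1 else 0) +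
    (if p.1 = p.2 + 1 then 1 else 0)

variable {N : ℕ} [NeZero N]

/-- The adjacency matrix of the cycle on `ZMod N`. -/
def cycleMatrix (N : ℕ) : Matrix (ZMod N) (ZMod N) ℝ :=
  Matrix.of fun i j => (if i + 1 = j then 1 else 0) + (if j + 1 = i then 1 else 0)

theorem lineMatrix_add_one (h : 2 < N) : lineMatrix (fun i : ZMod N => i + 1) = cycleMatrix N := by
  have : Fact (2 < N) := ⟨h⟩
  have : Fact (1 < N) := ⟨by omega⟩
  ext i j
  simp only [lineMatrix, cycleMatrix, of_apply, add_left_inj]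
  rcases eq_or_ne i j with rfl | hij <;> simp [*]

/-- The two rotations P and Pᵀ commute, so the binomial theorem expands (P + Pᵀ)^k. -/
theorem cycleMatrix_pow_apply (k : ℕ) (i j : ZMod N) : (cycleMatrix N ^ k) i j =
    walkWeights (fun p => if i + p.1 = j + p.2 then 1 else 0) k := by
  set P : Matrix (ZMod N) (ZMod N) ℝ := Matrix.of fun i j => if i + 1 = j then 1 else 0 with hP
  have hC : cycleMatrix N = P + Pᵀ := by ext; simp [cycleMatrix, hP]
  have hPe : ∀ i j, P i j = if i + 1 = j then 1 else 0 := fun _ _ => rfl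
  have hpow : ∀ (a : ℕ) (i j : ZMod N), (P ^ a) i j = if i + a = j then 1 else 0 := by
    intro a
    induction a with
    | zero => intro i j; simp [one_apply]
    | succ a ih =>
      intro i j
      rw [pow_succ, mul_apply]
      simp only [ih, hPe, ite_mul, zero_mul, one_mul]
      simp [← add_assoc]
  have hcomm : Commute P Pᵀ := by
    ext i j
    have e : ∀ x y : ZMod N, x + 1 = y ↔ x = y - 1 := fun x y => eq_sub_iff_add_eq.symm
    simp only [mul_apply, transpose_apply, hPe, ite_mul, zero_mul, one_mul]
    simp only [Finset.sum_ite_eq, mem_univ, if_true, add_left_inj]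
    simp [e _ i, eq_comm]
  rw [hC, hcomm.add_pow', Matrix.sum_apply, walkWeights]
  refine Finset.sum_congr rfl fun p _ => ?_
  rw [Matrix.smul_apply, nsmul_eq_mul, mul_apply]
  congr 1
  simp [← transpose_pow, hpow, eq_comm]

theorem trace_cycleMatrix_pow (k : ℕ) :
    trace (cycleMatrix N ^ k) = N * walkWeights (cycleWeight N) k := by
  simp only [trace, diag_apply, cycleMatrix_pow_apply, add_right_inj]
  rw [Finset.sum_const, Finset.card_univ, ZMod.card, nsmul_eq_mul]
  rfl

/-- A matrix on `V`, extended by zero to `Option V`. -/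
def extendZero (C : Matrix V V ℝ) : Matrix (Option V) (Option V) ℝ :=
  Matrix.of fun i j => i.elim 0 fun i => j.elim 0 fun j => C i j

theorem extendZero_pow_some (C : Matrix V V ℝ) (k : ℕ) (i j : V) :
    (extendZero C ^ k) (some i) (some j) = (C ^ k) i j := by
  induction k generalizing j with
  | zero => simp [one_apply]
  | succ k ih =>
    rw [pow_succ, pow_succ, mul_apply, mul_apply, Fintype.sum_option]
    simp only [ih]
    simp [extendZero]

theorem trace_extendZero_pow (C : Matrix V V ℝ) {k : ℕ} (hk : k ≠ 0) :
    trace (extendZero C ^ k) = trace (C ^ k) := by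
  have : (extendZero C ^ k) none none = 0 := by
    obtain ⟨k, rfl⟩ := Nat.exists_eq_succ_of_ne_zero hk
    rw [Nat.succ_eq_add_one, pow_succ, mul_apply]
    exact Finset.sum_eq_zero fun x _ => by cases x <;> simp [extendZero]
  simp [trace, Fintype.sum_option, this, extendZero_pow_some]

/-- The adjacencies of the pendant edge. -/
def pendantVector (N : ℕ) (v : Option (ZMod N)) : ℝ :=
  v.elim 0 fun i => (if i = 0 then 1 else 0) + (if i = -1 then 1 else 0)

/-- Index i stands for the edge {i, i + 1}, so the pendant edge at 0 meets exactly the edges 0 and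
-1. -/
theorem isBordering_pendantMap (h : 2 < N) : IsBordering (lineMatrix (pendantMap N))
    (extendZero (cycleMatrix N)) none (pendantVector N) where
  eq := by
    ext i j
    rcases i with _ | i <;> rcases j with _ | j
    · simp [lineMatrix, extendZero, pendantVector, vecMulVec_apply]
    · simp [lineMatrix, extendZero, pendantVector, vecMulVec_apply, pendantMap,
        eq_neg_iff_add_eq_zero, @eq_comm _ (0 : ZMod N)]
    · simp [lineMatrix, extendZero, pendantVector, vecMulVec_apply, pendantMap,
        eq_neg_iff_add_eq_zero, @eq_comm _ (0 : ZMod N)]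
    · rw [lineMatrix_apply_of_semiconj (φ := fun i : ZMod N => i + 1) (Option.some_injective _)
        (fun _ => rfl), lineMatrix_add_one h]
      simp [extendZero, vecMulVec_apply, pendantVector]
  col := by
    ext i; cases i <;> simp [extendZero]
  row := by
    ext i; cases i <;> simp [extendZero]
  self := rfl

theorem excursion_pendantVector (h : 2 < N) (s : ℕ) :
    excursion (extendZero (cycleMatrix N)) (pendantVector N) s =
      walkWeights (excursionWeight N) s := by
  have : Fact (1 < N) := ⟨by omega⟩
  have h1 : ∀ f : ZMod N → ℝ, ∑ i, ((if i = 0 then 1 else 0) + (if i = -1 then 1 else 0)) * f i =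
      f 0 + f (-1) := by
    intro f; simp [add_mul, Finset.sum_add_distrib]
  have h2 : ∀ f : ZMod N → ℝ, ∑ i, f i * ((if i = 0 then 1 else 0) + (if i = -1 then 1 else 0)) =
      f 0 + f (-1) := by
    intro f; simp [mul_add, Finset.sum_add_distrib]
  have e : excursion (extendZero (cycleMatrix N)) (pendantVector N) s =
      ((cycleMatrix N ^ s) 0 0 + (cycleMatrix N ^ s) 0 (-1)) +
        ((cycleMatrix N ^ s) (-1) 0 + (cycleMatrix N ^ s) (-1) (-1)) := by
    simp only [excursion, dotProduct, mulVec, Fintype.sum_option, pendantVector, Option.elim_none,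
      Option.elim_some, zero_mul, mul_zero, zero_add, extendZero_pow_some, h1, h2]
  rw [e]
  simp only [cycleMatrix_pow_apply, walkWeights, ← Finset.sum_add_distrib]
  refine Finset.sum_congr rfl fun p _ => ?_
  simp only [excursionWeight, add_right_inj, zero_add]
  have e1 : ((p.1 : ZMod N) = -1 + p.2) ↔ ((p.1 + 1 : ZMod N) = p.2) := by
    constructor <;> intro h
    · rw [h]; ring
    · rw [← h]; ring
  have e2 : (-1 + (p.1 : ZMod N) = p.2) ↔ ((p.1 : ZMod N) = p.2 + 1) := by
    constructor <;> intro h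
    · rw [← h]; ring
    · rw [h]; ring
  simp only [e1, e2]
  ring

theorem trace_pow_pendantMap (h : 2 < N) {k : ℕ} (hk : k ≠ 0) :
    trace (lineMatrix (pendantMap N) ^ k) = N * walkWeights (cycleWeight N) k +
      PowerSeries.coeff k (through (walkWeights (excursionWeight N))) := by
  rw [(isBordering_pendantMap h).trace_pow hk, trace_extendZero_pow _ hk, trace_cycleMatrix_pow,
    funext (excursion_pendantVector h)]

/-- The line graph of the cycle with a pendant vertex has maximum degree 3. -/
theorem coeff_returns_excursionWeight_le (h : 2 < N) (j : ℕ) :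
    PowerSeries.coeff j (returns (walkWeights (excursionWeight N))) ≤ 3 ^ j := by
  rw [← funext (excursion_pendantVector h), (isBordering_pendantMap h).coeff_returns]
  have hnn := lineMatrix_nonneg (pendantMap N)
  have hrow : ∀ i, ∑ l, lineMatrix (pendantMap N) i l ≤ 3 := by
    intro i
    rw [(isBordering_pendantMap h).eq]
    rcases i with _ | i
    · simp [Fintype.sum_option, extendZero, pendantVector, vecMulVec_apply, Finset.sum_add_distrib]
      norm_num
    · have hv : pendantVector N (some i) ≤ 1 := by
        have : Fact (1 < N) := ⟨by omega⟩
        simp only [pendantVector, Option.elim_some]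
        by_cases h0 : i = 0
        · subst h0
          simp
        · rw [if_neg h0]; split_ifs <;> norm_num
      have : ∑ j, cycleMatrix N i j = 2 := by
        have e : ∀ x : ZMod N, x + 1 = i ↔ x = i - 1 := fun x => eq_sub_iff_add_eq.symm
        simp only [cycleMatrix, of_apply, Finset.sum_add_distrib, e]
        simp; norm_num
      simp [Fintype.sum_option, extendZero, vecMulVec_apply, this]
      linarith
  have hsum : ∀ (k : ℕ) i, ∑ l, (lineMatrix (pendantMap N) ^ k) i l ≤ 3 ^ k := by
    intro k
    induction k with
    | zero => intro i; simp [one_apply]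
    | succ k ih =>
      intro i
      simp only [pow_succ, mul_apply]
      rw [Finset.sum_comm]
      calc _ = ∑ m, (lineMatrix (pendantMap N) ^ k) i m * ∑ l, lineMatrix (pendantMap N) m l := by
            simp only [Finset.mul_sum]
        _ ≤ ∑ m, (lineMatrix (pendantMap N) ^ k) i m * 3 := Finset.sum_le_sum fun m _ =>
            mul_le_mul_of_nonneg_left (hrow m) (pow_apply_nonneg hnn _ _ _)
        _ ≤ _ := by rw [← Finset.sum_mul]; exact mul_le_mul_of_nonneg_right (ih i) (by norm_num)
  exact (Finset.single_le_sum (fun l _ => pow_apply_nonneg hnn j none l) (mem_univ none)).trans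
    (hsum j none)

theorem lineExcursionWeight_nonneg (p : ℕ × ℕ) : 0 ≤ lineExcursionWeight p := by
  rw [lineExcursionWeight]; split_ifs <;> norm_num

theorem lineExcursionWeight_le (p : ℕ × ℕ) : lineExcursionWeight p ≤ excursionWeight N p := by
  have h : ∀ a b : ℕ, (if a = b then (1 : ℝ) else 0) ≤ if (a : ZMod N) = b then 1 else 0 := by
    intro a b
    by_cases h : a = b
    · simp [h]
    · rw [if_neg h]; split_ifs <;> norm_num
  have h1 := h p.1 p.2
  have h2 := h (p.1 + 1) p.2
  have h3 := h p.1 (p.2 + 1)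
  push_cast at h2 h3
  rw [lineExcursionWeight, excursionWeight]
  linarith

/-- The indicator of the walks with displacement at least `m`, on both sides. -/
def farWeight (m : ℕ) (p : ℕ × ℕ) : ℝ :=
  (if p.2 + m ≤ p.1 then 1 else 0) + (if p.1 + m ≤ p.2 then 1 else 0)

theorem farWeight_nonneg (m : ℕ) (p : ℕ × ℕ) : 0 ≤ farWeight m p := by
  rw [farWeight]; split_ifs <;> norm_num

theorem zmod_cast_eq_iff {a b : ℕ} (h1 : a < b + N) (h2 : b < a + N) :
    (a : ZMod N) = b ↔ a = b := by
  refine ⟨fun h => ?_, fun h => by rw [h]⟩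
  rw [ZMod.natCast_eq_natCast_iff, Nat.modEq_iff_dvd] at h
  have := Int.eq_zero_of_abs_lt_dvd h (abs_lt.2 ⟨by omega, by omega⟩)
  omega

theorem cycleWeight_le (p : ℕ × ℕ) : cycleWeight N p ≤ lineWeight p + farWeight N p := by
  have h0 := farWeight_nonneg N p
  rw [cycleWeight, lineWeight]
  by_cases h : p.1 < p.2 + N ∧ p.2 < p.1 + N
  · simp only [zmod_cast_eq_iff h.1 h.2]
    linarith
  · have : 1 ≤ farWeight N p := by
      rw [farWeight]
      rcases not_and_or.1 h with h | h
      · rw [if_pos (show p.2 + N ≤ p.1 by omega)]; split_ifs <;> norm_num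
      · rw [if_pos (show p.1 + N ≤ p.2 by omega)]; split_ifs <;> norm_num
    split_ifs <;> linarith

theorem le_cycleWeight (p : ℕ × ℕ) : lineWeight p + ((if p.1 = p.2 + N then 1 else 0) +
    (if p.2 = p.1 + N then 1 else 0)) ≤ cycleWeight N p := by
  have hN := NeZero.pos N
  rw [cycleWeight, lineWeight]
  by_cases h1 : p.1 = p.2
  · simp [h1, hN.ne']
  · by_cases h2 : p.1 = p.2 + N
    · simp [h2, hN.ne', show ¬ (p.2 = p.2 + N + N) by omega]
    · by_cases h3 : p.2 = p.1 + N
      · simp [h3, hN.ne', show ¬ (p.1 = p.1 + N + N) by omega]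
      · simp only [h1, h2, h3, if_false]
        split_ifs <;> norm_num

/-- Below displacement N - 1 all three congruences are equalities, the shifts by 1 costing one unit;
beyond it the excursion weight is still at most 2. -/
theorem excursionWeight_sub_le (h : 2 < N) (p : ℕ × ℕ) :
    excursionWeight N p - lineExcursionWeight p ≤ 2 * farWeight (N - 1) p := by
  have : Fact (1 < N) := ⟨by omega⟩
  by_cases hp : p.1 < p.2 + (N - 1) ∧ p.2 < p.1 + (N - 1)
  · have h1 := zmod_cast_eq_iff (N := N) (a := p.1) (b := p.2) (by omega) (by omega)
    have h2 := zmod_cast_eq_iff (N := N) (a := p.1 + 1) (b := p.2) (by omega) (by omega)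
    have h3 := zmod_cast_eq_iff (N := N) (a := p.1) (b := p.2 + 1) (by omega) (by omega)
    push_cast at h2 h3
    have := farWeight_nonneg (N - 1) p
    simp only [excursionWeight, lineExcursionWeight, h1, h2, h3]
    linarith
  · have h1 : 1 ≤ farWeight (N - 1) p := by
      rw [farWeight]
      rcases not_and_or.1 hp with h | h
      · rw [if_pos (show p.2 + (N - 1) ≤ p.1 by omega)]; split_ifs <;> norm_num
      · rw [if_pos (show p.1 + (N - 1) ≤ p.2 by omega)]; split_ifs <;> norm_num
    have h2 : excursionWeight N p ≤ 2 := by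
      rw [excursionWeight]
      by_cases e : (p.1 : ZMod N) = p.2
      · simp [e]
      · rw [if_neg e]
        split_ifs <;> norm_num
    have := lineExcursionWeight_nonneg p
    linarith

end Model

/-! ### Exponential sums over walks and the values I_m(2). -/

section Sums

/-- The exponential weight of the walks with given numbers of steps to the right and left. -/
noncomputable def expWeight (p : ℕ × ℕ) : ℝ := 1 / p.1.factorial * (1 / p.2.factorial)

theorem expWeight_pos (p : ℕ × ℕ) : 0 < expWeight p := by
  rw [expWeight]; positivity

theorem hasSum_one_div_factorial : HasSum (fun k : ℕ => 1 / (k.factorial : ℝ)) (Real.exp 1) := by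
  have := NormedSpace.exp_series_hasSum_exp' (𝕂 := ℝ) (1 : ℝ)
  rw [Real.exp_eq_exp_ℝ]
  simpa using this

theorem summable_expWeight : Summable expWeight :=
  hasSum_one_div_factorial.summable.mul_of_nonneg hasSum_one_div_factorial.summable
    (fun _ => by positivity) (fun _ => by positivity)

/-- The weighted sum over all walks on the line. -/
noncomputable def total (θ : ℕ × ℕ → ℝ) : ℝ := ∑' p, θ p * expWeight p

/-- Nonnegative weights that are bounded. -/
def Admissible (θ : ℕ × ℕ → ℝ) : Prop := (∀ p, 0 ≤ θ p) ∧ ∃ B, ∀ p, θ p ≤ B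

variable {θ η : ℕ × ℕ → ℝ}

theorem Admissible.hasSum (h : Admissible θ) : HasSum (fun p => θ p * expWeight p) (total θ) := by
  obtain ⟨h0, B, hB⟩ := h
  exact (Summable.of_nonneg_of_le (fun p => mul_nonneg (h0 p) (expWeight_pos p).le)
    (fun p => mul_le_mul_of_nonneg_right (hB p) (expWeight_pos p).le)
    (summable_expWeight.mul_left B)).hasSum

theorem total_mono (hθ : Admissible θ) (hη : Admissible η) (h : ∀ p, θ p ≤ η p) :
    total θ ≤ total η :=
  hasSum_le (fun p => mul_le_mul_of_nonneg_right (h p) (expWeight_pos p).le) hθ.hasSum hη.hasSum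

theorem total_add (hθ : Admissible θ) (hη : Admissible η) :
    total (fun p => θ p + η p) = total θ + total η := by
  have := hθ.hasSum.add hη.hasSum
  simp only [← add_mul] at this
  exact this.tsum_eq

theorem total_const_mul (c : ℝ) : total (fun p => c * θ p) = c * total θ := by
  simp only [total, mul_assoc, tsum_mul_left]

theorem Admissible.add (hθ : Admissible θ) (hη : Admissible η) :
    Admissible fun p => θ p + η p := by
  obtain ⟨h0, B, hB⟩ := hθ
  obtain ⟨h0', B', hB'⟩ := hη
  exact ⟨fun p => add_nonneg (h0 p) (h0' p), B + B', fun p => add_le_add (hB p) (hB' p)⟩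

theorem Admissible.const_mul (hθ : Admissible θ) {c : ℝ} (hc : 0 ≤ c) :
    Admissible fun p => c * θ p := by
  obtain ⟨h0, B, hB⟩ := hθ
  exact ⟨fun p => mul_nonneg hc (h0 p), c * B, fun p => mul_le_mul_of_nonneg_left (hB p) hc⟩

theorem admissible_ite (P : ℕ × ℕ → Prop) [DecidablePred P] :
    Admissible fun p => if P p then 1 else 0 :=
  ⟨fun p => by beta_reduce; split_ifs <;> norm_num, 1,
    fun p => by beta_reduce; split_ifs <;> norm_num⟩

theorem total_swap (θ : ℕ × ℕ → ℝ) : total (fun p => θ p.swap) = total θ := by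
  rw [total, total, ← (Equiv.prodComm ℕ ℕ).tsum_eq]
  refine tsum_congr fun p => ?_
  simp [expWeight, mul_comm]

theorem hasSum_sum_antidiagonal {f : ℕ × ℕ → ℝ} {S : ℝ} (hf : HasSum f S) :
    HasSum (fun k => ∑ p ∈ antidiagonal k, f p) S := by
  have h1 := (Finset.HasAntidiagonal.sigmaAntidiagonalEquivProd (A := ℕ)).hasSum_iff.2 hf
  have h2 := h1.sigma (fun k => hasSum_fintype _)
  refine h2.congr_fun fun k => ?_
  rw [← Finset.sum_coe_sort]
  rfl

/-- Grouping by length: a binomial coefficient over s! is 1/(a! b!), with a and b the numbers of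
steps each way. -/
theorem Admissible.hasSum_walkWeights (h : Admissible θ) :
    HasSum (fun s : ℕ => walkWeights θ s / s.factorial) (total θ) := by
  refine (hasSum_sum_antidiagonal h.hasSum).congr_fun fun s => ?_
  rw [walkWeights, Finset.sum_div]
  refine Finset.sum_congr rfl fun p hp => ?_
  have hp := HasAntidiagonal.mem_antidiagonal.1 hp
  have hc : (s.choose p.1 : ℝ) * (p.1.factorial * p.2.factorial) = s.factorial := by
    have := Nat.choose_mul_factorial_mul_factorial (show p.1 ≤ s by omega)
    rw [show s - p.1 = p.2 by omega] at this
    rw [← mul_assoc]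
    exact_mod_cast this
  have h1 : (p.1.factorial : ℝ) ≠ 0 := by positivity
  have h2 : (p.2.factorial : ℝ) ≠ 0 := by positivity
  have h3 : (s.factorial : ℝ) ≠ 0 := by positivity
  rw [expWeight]
  field_simp
  linear_combination (θ p) * hc

/-- The modified Bessel function `I_m` at `2`. -/
noncomputable def bessel (m : ℕ) : ℝ :=
  ∑' b : ℕ, 1 / ((b + m).factorial : ℝ) * (1 / b.factorial)

/-- The value at `2` of the sum of the modified Bessel functions from `I_m` on. -/
noncomputable def tail (m : ℕ) : ℝ := total fun p => if p.2 + m ≤ p.1 then 1 else 0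

theorem hasSum_bessel (m : ℕ) :
    HasSum (fun b : ℕ => 1 / ((b + m).factorial : ℝ) * (1 / b.factorial)) (bessel m) := by
  refine (Summable.of_nonneg_of_le (fun b => by positivity) (fun b => ?_)
    hasSum_one_div_factorial.summable).hasSum
  refine mul_le_of_le_one_left (by positivity) ?_
  rw [div_le_one (by positivity)]
  exact_mod_cast Nat.succ_le_of_lt (Nat.factorial_pos _)

theorem bessel_pos (m : ℕ) : 0 < bessel m :=
  (hasSum_bessel m).summable.tsum_pos (fun b => by positivity) 0 (by positivity)

theorem total_eq_bessel (m : ℕ) : total (fun p => if p.1 = p.2 + m then 1 else 0) = bessel m := by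
  have hinj : Function.Injective fun b : ℕ => (b + m, b) := fun a b h => (Prod.ext_iff.1 h).2
  rw [total, bessel, ← hinj.tsum_eq]
  · exact tsum_congr fun b => by simp [expWeight]
  · rintro ⟨a, b⟩ h
    refine ⟨b, ?_⟩
    by_contra hne
    refine h ?_
    simp only
    rw [if_neg, zero_mul]
    rintro rfl
    exact hne rfl

theorem total_lineWeight : total lineWeight = bessel 0 := total_eq_bessel 0

theorem total_farWeight (m : ℕ) : total (farWeight m) = 2 * tail m := by
  have h1 := admissible_ite fun p : ℕ × ℕ => p.2 + m ≤ p.1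
  have h2 := admissible_ite fun p : ℕ × ℕ => p.1 + m ≤ p.2
  have h3 : total (fun p : ℕ × ℕ => if p.1 + m ≤ p.2 then 1 else 0) = tail m :=
    total_swap fun p => if p.2 + m ≤ p.1 then 1 else 0
  rw [show farWeight m = fun p => (if p.2 + m ≤ p.1 then 1 else 0) +
    (if p.1 + m ≤ p.2 then 1 else 0) from rfl, total_add h1 h2, h3, two_mul]
  rfl

theorem factorial_succ_le_bound (m i : ℕ) (b : ℕ) :
    1 / ((b + m + i).factorial : ℝ) * (1 / b.factorial) ≤
      (1 / ((m : ℝ) + 1)) ^ i * (1 / ((b + m).factorial : ℝ) * (1 / b.factorial)) := by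
  rw [← mul_assoc]
  refine mul_le_mul_of_nonneg_right ?_ (by positivity)
  rw [div_pow, one_pow, div_mul_div_comm, one_mul]
  refine one_div_le_one_div_of_le (by positivity) ?_
  have h1 : (b + m).factorial * (b + m + 1) ^ i ≤ (b + m + i).factorial :=
    Nat.factorial_mul_pow_le_factorial
  have h2 : (m + 1) ^ i ≤ (b + m + 1) ^ i := Nat.pow_le_pow_left (by omega) i
  have h3 : (m + 1) ^ i * (b + m).factorial ≤ (b + m + i).factorial := by
    rw [mul_comm]; exact (Nat.mul_le_mul_left _ h2).trans h1
  exact_mod_cast h3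

/-- Since I_(m+i) ≤ (m+1)^(-i) I_m, the tail is dominated by a geometric series. -/
theorem tail_le (m : ℕ) (hm : 0 < m) : tail m ≤ ((m : ℝ) + 1) / m * bessel m := by
  have hinj : Function.Injective fun q : ℕ × ℕ => (q.2 + m + q.1, q.2) := by
    rintro ⟨a, b⟩ ⟨c, d⟩ h
    simp only [Prod.mk.injEq] at h ⊢
    omega
  have h1 : tail m = ∑' q : ℕ × ℕ, 1 / ((q.2 + m + q.1).factorial : ℝ) * (1 / q.2.factorial) := by
    rw [tail, total, ← hinj.tsum_eq]
    · exact tsum_congr fun b => by simp [expWeight]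
    · rintro ⟨a, b⟩ h
      refine ⟨(a - (b + m), b), ?_⟩
      have : b + m ≤ a := by
        by_contra hne
        exact h (by simp only; rw [if_neg hne, zero_mul])
      simp only [Prod.mk.injEq, and_true]
      omega
  have hm' : (0 : ℝ) < m := by exact_mod_cast hm
  have hg : HasSum (fun i : ℕ => (1 / ((m : ℝ) + 1)) ^ i) (((m : ℝ) + 1) / m) := by
    have := hasSum_geometric_of_lt_one (r := 1 / ((m : ℝ) + 1)) (by positivity)
      (by rw [div_lt_one (by positivity)]; linarith)
    convert this using 1
    rw [eq_comm, inv_eq_iff_eq_inv, inv_div, one_sub_div (by positivity), add_sub_cancel_right]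
  have hp := hg.mul (hasSum_bessel m) (hg.summable.mul_of_nonneg
    (hasSum_bessel m).summable (fun _ => by positivity) (fun _ => by positivity))
  rw [h1, ← hp.tsum_eq]
  refine Summable.tsum_le_tsum (fun q => factorial_succ_le_bound m q.1 q.2) ?_ hp.summable
  exact Summable.of_nonneg_of_le (fun q => by positivity)
    (fun q => factorial_succ_le_bound m q.1 q.2) hp.summable

theorem bessel_succ_le (m : ℕ) : bessel (m + 1) ≤ bessel m / (m + 1) := by
  rw [div_eq_inv_mul, ← one_div]
  refine hasSum_le (fun b => ?_) (hasSum_bessel (m + 1)) ((hasSum_bessel m).mul_left _)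
  have := factorial_succ_le_bound m 1 b
  rwa [pow_one] at this

theorem bessel_le_div_factorial (m : ℕ) : bessel m ≤ bessel 0 / m.factorial := by
  induction m with
  | zero => simp
  | succ m ih =>
    refine (bessel_succ_le m).trans ?_
    rw [Nat.factorial_succ, mul_comm, Nat.cast_mul, ← div_div]
    push_cast
    exact div_le_div_of_nonneg_right ih (by positivity)

theorem bessel_zero_lt : bessel 0 < 2.7182818286 := by
  refine lt_of_le_of_lt ?_ Real.exp_one_lt_d9
  refine hasSum_le (fun b => ?_) (hasSum_bessel 0) hasSum_one_div_factorial
  refine mul_le_of_le_one_left (by positivity) ?_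
  rw [div_le_one (by positivity)]
  exact_mod_cast Nat.succ_le_of_lt (Nat.factorial_pos _)

theorem hasSum_centralWalks :
    HasSum (fun k : ℕ => centralWalks k / k.factorial) (bessel 0) := by
  have h := (admissible_ite fun p : ℕ × ℕ => p.1 = p.2).hasSum_walkWeights
  simp only [← walkWeights_lineWeight]
  rw [← total_lineWeight]
  exact h

end Sums

/-! ### Cycles lie below the cycle with a pendant vertex. -/

section Comparison

variable {N : ℕ} [NeZero N]

theorem admissible_cycleWeight (N : ℕ) : Admissible (cycleWeight N) :=
  admissible_ite _

theorem admissible_farWeight (m : ℕ) : Admissible (farWeight m) :=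
  (admissible_ite _).add (admissible_ite _)

theorem total_cycleWeight_le : total (cycleWeight N) ≤ bessel 0 + 2 * tail N := by
  rw [← total_lineWeight, ← total_farWeight]
  have h1 : Admissible lineWeight := admissible_ite _
  rw [← total_add h1 (admissible_farWeight N)]
  exact total_mono (admissible_cycleWeight N) (h1.add (admissible_farWeight N)) cycleWeight_le

theorem le_total_cycleWeight : bessel 0 + 2 * bessel N ≤ total (cycleWeight N) := by
  have h1 : Admissible lineWeight := admissible_ite _
  have h2 := admissible_ite fun p : ℕ × ℕ => p.1 = p.2 + N
  have h3 := admissible_ite fun p : ℕ × ℕ => p.2 = p.1 + N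
  have h4 : total (fun p : ℕ × ℕ => if p.2 = p.1 + N then 1 else 0) = bessel N := by
    rw [← total_eq_bessel, ← total_swap]; rfl
  refine le_trans (le_of_eq ?_) (total_mono (h1.add (h2.add h3)) (admissible_cycleWeight N)
    le_cycleWeight)
  rw [total_add h1 (h2.add h3), total_add h2 h3, h4, total_eq_bessel, total_lineWeight]
  ring

theorem estrada_cycleMatrix : estrada (cycleMatrix N) = N * total (cycleWeight N) := by
  rw [← ((admissible_cycleWeight N).hasSum_walkWeights.mul_left (N : ℝ)).tsum_eq]
  exact tsum_congr fun k => by rw [trace_cycleMatrix_pow, mul_div_assoc]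

theorem hasSum_estrada_pendantMap (N : ℕ) [NeZero N] :
    HasSum (fun k : ℕ => trace (lineMatrix (pendantMap N) ^ k) / k.factorial)
      (estrada (lineMatrix (pendantMap N))) :=
  hasSum_estrada (isHermitian_lineMatrix _)

theorem through_lineExcursionWeight_le (h : 2 < N) {k : ℕ} (hk : k ≠ 0) :
    N * walkWeights (cycleWeight N) k +
      PowerSeries.coeff k (through (walkWeights lineExcursionWeight)) ≤
        trace (lineMatrix (pendantMap N) ^ k) := by
  rw [trace_pow_pendantMap h hk]
  exact add_le_add_right (coeff_through_mono (walkWeights_nonneg lineExcursionWeight_nonneg)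
    (walkWeights_mono lineExcursionWeight_le) k) _

/-- Beyond the N I_0 from walks on ℤ, lengths 0, 2 and 3 alone contribute at least 1 + 4/2! + 6/3! =
4. -/
theorem add_four_le_estrada_pendantMap (h : 2 < N) :
    N * bessel 0 + 4 ≤ estrada (lineMatrix (pendantMap N)) := by
  have h1 := (hasSum_estrada_pendantMap N).sub (hasSum_centralWalks.mul_left (N : ℝ))
  have hc : ∀ k, centralWalks k ≤ walkWeights (cycleWeight N) k := fun k => by
    rw [← walkWeights_lineWeight]
    refine walkWeights_mono (fun p => ?_) k
    refine le_trans ?_ (le_cycleWeight p)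
    have := (((admissible_ite fun p : ℕ × ℕ => p.1 = p.2 + N).add
      (admissible_ite fun p : ℕ × ℕ => p.2 = p.1 + N)).1 p)
    linarith
  have hk : ∀ k ≠ 0, PowerSeries.coeff k (through (walkWeights lineExcursionWeight)) ≤
      trace (lineMatrix (pendantMap N) ^ k) - N * centralWalks k := fun k hk => by
    have h2 := through_lineExcursionWeight_le h hk
    have h3 := mul_le_mul_of_nonneg_left (hc k) (Nat.cast_nonneg (α := ℝ) N)
    linarith
  have h0 : trace (lineMatrix (pendantMap N) ^ 0) - N * centralWalks 0 = 1 := by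
    have := centralWalks_two_mul 0
    simp only [mul_zero, Nat.centralBinom_zero] at this
    simp [this, ZMod.card]
  have hnn : ∀ k, 0 ≤ trace (lineMatrix (pendantMap N) ^ k) - N * centralWalks k := fun k => by
    rcases eq_or_ne k 0 with rfl | hk0
    · rw [h0]; norm_num
    · exact (coeffNonneg_through (walkWeights_nonneg lineExcursionWeight_nonneg) k).trans (hk k hk0)
  have hsum := sum_le_hasSum (range 4) (fun k _ => by
    have := hnn k
    rw [← mul_div_assoc, ← sub_div]
    positivity) h1
  have e0 : walkWeights lineExcursionWeight 0 = 2 := by simp [walkWeights, lineExcursionWeight]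
  have e1 : walkWeights lineExcursionWeight 1 = 2 := by
    simp [walkWeights, lineExcursionWeight, Finset.Nat.antidiagonal_succ]; norm_num
  have c2 : (4 : ℝ) ≤ trace (lineMatrix (pendantMap N) ^ 2) - N * centralWalks 2 := by
    refine le_trans (le_of_eq ?_) (hk 2 (by norm_num))
    rw [coeff_through_add_two 0]
    simp [coeff_zero_returns, e0]; norm_num
  have c3 : (6 : ℝ) ≤ trace (lineMatrix (pendantMap N) ^ 3) - N * centralWalks 3 := by
    refine le_trans (le_of_eq ?_) (hk 3 (by norm_num))
    rw [coeff_through_add_two 1]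
    simp [Finset.sum_range_succ, coeff_zero_returns, coeff_one_returns, e1]; norm_num
  have c1 := hnn 1
  simp only [← mul_div_assoc, ← sub_div, Finset.sum_range_succ, Finset.sum_range_zero, h0] at hsum
  norm_num [Nat.factorial] at hsum c1
  linarith

theorem estrada_cycleMatrix_lt {q : ℕ} [NeZero q] (hq : 2 < q) (hN : 2 < N) (hqN : q ≤ N + 1) :
    estrada (cycleMatrix q) < estrada (lineMatrix (pendantMap N)) := by
  refine lt_of_lt_of_le ?_ (add_four_le_estrada_pendantMap hN)
  rw [estrada_cycleMatrix]
  have hq0 : (0 : ℝ) < q := by exact_mod_cast (by omega : 0 < q)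
  have hI := bessel_pos 0
  have hI2 := bessel_zero_lt
  have h1 := mul_le_mul_of_nonneg_left (total_cycleWeight_le (N := q)) hq0.le
  have h2 := mul_le_mul_of_nonneg_left (tail_le q (by omega)) hq0.le
  have h3 : (q : ℝ) * (((q : ℝ) + 1) / q * bessel q) = (q + 1) * bessel q := by field_simp
  rw [h3] at h2
  have h4 := bessel_le_div_factorial q
  -- (q + 1)/q! is largest at q = 3, with value 4/6.
  have hfac : ∀ m : ℕ, 6 * (m + 4) ≤ 4 * (m + 3).factorial := by
    intro m
    induction m with
    | zero => decide
    | succ m ih =>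
      rw [show m + 1 + 3 = (m + 3) + 1 by ring, Nat.factorial_succ]
      nlinarith [Nat.factorial_pos (m + 3)]
  have h5 : ((q : ℝ) + 1) * bessel q ≤ 4 / 6 * bessel 0 := by
    obtain ⟨m, rfl⟩ : ∃ m, q = m + 3 := ⟨q - 3, by omega⟩
    refine (mul_le_mul_of_nonneg_left h4 (by positivity)).trans ?_
    have := hfac m
    have : (6 : ℝ) * (m + 4) ≤ 4 * (m + 3).factorial := by exact_mod_cast this
    have hf : (0 : ℝ) < (m + 3).factorial := by positivity
    rw [mul_div_assoc', div_le_iff₀ hf]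
    push_cast
    nlinarith
  -- For q = N + 1 an extra I_0 must also fit below 4. There q ≥ 4, so 5/4! replaces 4/3!, and (1 +
  -- 2 · 5/24) I_0 < 4 because I_0 < e.
  rcases Nat.lt_or_ge N q with hlt | hge
  · obtain rfl : q = N + 1 := by omega
    have h6 : ((N + 1 : ℕ) + 1 : ℝ) * bessel (N + 1) ≤ 5 / 24 * bessel 0 := by
      have hfac : ∀ m : ℕ, 24 * (m + 5) ≤ 5 * (m + 4).factorial := by
        intro m
        induction m with
        | zero => decide
        | succ m ih =>
          rw [show m + 1 + 4 = (m + 4) + 1 by ring, Nat.factorial_succ]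
          nlinarith [Nat.factorial_pos (m + 4)]
      obtain ⟨m, rfl⟩ : ∃ m, N = m + 3 := ⟨N - 3, by omega⟩
      refine (mul_le_mul_of_nonneg_left h4 (by positivity)).trans ?_
      have := hfac m
      have : (24 : ℝ) * (m + 5) ≤ 5 * (m + 3 + 1).factorial := by exact_mod_cast this
      have hf : (0 : ℝ) < (m + 3 + 1).factorial := by positivity
      rw [mul_div_assoc', div_le_iff₀ hf]
      push_cast
      nlinarith
    push_cast at *
    nlinarith
  · have : (q : ℝ) ≤ N := by exact_mod_cast hge
    nlinarith

end Comparison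

/-! ### Lengthening the cycle by one gains less than I_0(2). -/

section Growth

theorem walkWeights_farWeight_eq_zero {N s : ℕ} (h : s < N) :
    walkWeights (fun p => 2 * farWeight N p) s = 0 := by
  refine Finset.sum_eq_zero fun p hp => ?_
  have := HasAntidiagonal.mem_antidiagonal.1 hp
  simp only [farWeight]
  rw [if_neg (by omega), if_neg (by omega)]
  ring

theorem factorial_mul_pow_le {N s : ℕ} (h : N ≤ s) (l : ℕ) :
    (N + 1) * s.factorial * (N + 2) ^ l ≤ (s + l + 1).factorial := by
  have h1 : (s + 1).factorial * (s + 1 + 1) ^ l ≤ (s + 1 + l).factorial :=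
    Nat.factorial_mul_pow_le_factorial
  rw [show s + l + 1 = s + 1 + l by ring]
  refine le_trans ?_ h1
  rw [Nat.factorial_succ]
  exact Nat.mul_le_mul (Nat.mul_le_mul_right _ (by omega)) (Nat.pow_le_pow_left (by omega) l)

/-- The contribution to the Estrada index of the walks with an excursion around the cycle. -/
theorem exists_hasSum_excursion_bound {N : ℕ} (hN : 2 < N) :
    ∃ L : ℕ → ℝ, HasSum L (1 / (N + 1) * (2 * (2 * tail N) * (((N : ℝ) + 2) / (N - 1)))) ∧
      ∀ k : ℕ, k * PowerSeries.coeff k (firstReturn (walkWeights (excursionWeight (N + 1)) -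
        walkWeights lineExcursionWeight) * returns (walkWeights (excursionWeight (N + 1)))) /
          k.factorial ≤ L k := by
  set D := walkWeights fun p => 2 * farWeight N p with hD
  have hDadm : Admissible fun p => 2 * farWeight N p :=
    (admissible_farWeight N).const_mul (by norm_num)
  have hD0 : ∀ s, 0 ≤ D s := walkWeights_nonneg hDadm.1
  have hDsum : HasSum (fun s : ℕ => D s / s.factorial) (2 * (2 * tail N)) := by
    rw [← total_farWeight, ← total_const_mul]
    exact hDadm.hasSum_walkWeights
  have hN' : (2 : ℝ) < N := by exact_mod_cast hN
  have hg : HasSum (fun i : ℕ => (3 / ((N : ℝ) + 2)) ^ i) (((N : ℝ) + 2) / (N - 1)) := by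
    have := hasSum_geometric_of_lt_one (r := 3 / ((N : ℝ) + 2)) (by positivity)
      (by rw [div_lt_one (by positivity)]; linarith)
    convert this using 1
    rw [eq_comm, inv_eq_iff_eq_inv, inv_div, one_sub_div (by positivity)]
    congr 1; ring
  have hprod := (hasSum_sum_antidiagonal (hDsum.mul hg (hDsum.summable.mul_of_nonneg hg.summable
    (fun _ => div_nonneg (hD0 _) (by positivity)) (fun _ => by positivity)))).mul_left
      (1 / ((N : ℝ) + 1))
  set u : ℕ → ℝ := fun m => 1 / ((N : ℝ) + 1) * ∑ p ∈ antidiagonal m,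
    D p.1 / p.1.factorial * (3 / ((N : ℝ) + 2)) ^ p.2 with hu
  refine ⟨fun k => if k < 2 then 0 else u (k - 2), ?_, ?_⟩
  · rw [← hasSum_nat_add_iff' 2]
    simpa [Finset.sum_range_succ] using hprod
  · intro k
    rcases k with _ | _ | m
    · simp
    · simp [firstReturn, mul_assoc, PowerSeries.coeff_X_pow_mul']
    · beta_reduce
      rw [if_neg (by omega), show m + 1 + 1 = m + 2 from rfl, coeff_firstReturn_mul,
        Nat.add_sub_cancel]
      -- The factor k cancels against k!, leaving (i + l + 1)! below an excursion with i inner steps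
      -- and a return of length l.
      have hfac : ((m + 2 : ℕ) : ℝ) / (m + 2).factorial = 1 / (m + 1).factorial := by
        rw [Nat.factorial_succ, Nat.cast_mul, div_mul_cancel_left₀ (by positivity), one_div]
      rw [mul_comm, mul_div_assoc, hfac, hu]
      simp only
      rw [Finset.Nat.sum_antidiagonal_eq_sum_range_succ_mk, Finset.sum_mul, Finset.mul_sum,
        ← Finset.sum_range_reflect]
      refine Finset.sum_le_sum fun i hi => ?_
      have hi := Finset.mem_range.1 hi
      rw [show m - (m + 1 - 1 - i) = i by omega, show m + 1 - 1 - i = m - i by omega]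
      obtain ⟨l, rfl⟩ : ∃ l, m = i + l := ⟨m - i, by omega⟩
      rw [Nat.add_sub_cancel_left]
      have hδ : (walkWeights (excursionWeight (N + 1)) - walkWeights lineExcursionWeight) i ≤
          D i := by
        have := walkWeights_mono (excursionWeight_sub_le (N := N + 1) (by omega)) i
        rw [Nat.add_sub_cancel] at this
        refine le_trans (le_of_eq ?_) this
        simp only [Pi.sub_apply, walkWeights, ← Finset.sum_sub_distrib, mul_sub]
      have hY := coeff_returns_excursionWeight_le (N := N + 1) (by omega) l
      have hY0 : 0 ≤ PowerSeries.coeff l (returns (walkWeights (excursionWeight (N + 1)))) :=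
        coeffNonneg_returns (walkWeights_nonneg fun p =>
          (lineExcursionWeight_nonneg p).trans (lineExcursionWeight_le p)) l
      refine le_trans (mul_le_mul_of_nonneg_right (mul_le_mul hδ hY hY0 (hD0 i))
        (by positivity)) ?_
      -- An excursion around the cycle needs at least N inner steps. From there on the factorial
      -- absorbs (N + 2)^l, and the 3^l returns sum geometrically.
      rcases Nat.lt_or_ge i N with h | h
      · rw [hD, walkWeights_farWeight_eq_zero h]; simp
      · have hf : (((N : ℝ) + 1) * i.factorial * (N + 2) ^ l) ≤ (i + l + 1).factorial := by
          exact_mod_cast factorial_mul_pow_le h l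
        calc _ ≤ D i * 3 ^ l * (1 / (((N : ℝ) + 1) * i.factorial * (N + 2) ^ l)) :=
              mul_le_mul_of_nonneg_left (one_div_le_one_div_of_le (by positivity) hf)
                (mul_nonneg (hD0 i) (by positivity))
          _ = _ := by rw [div_pow]; field_simp

/-- Both pendant edges are compared with one attached to the infinite line: from below for N, and
for N + 1 from above up to the winding excursions. The line terms cancel, and the rest is measured
in units of I_N. -/
theorem estrada_pendantMap_succ_lt {N : ℕ} [NeZero N] (hN : 2 < N) :
    estrada (lineMatrix (pendantMap (N + 1))) <
      estrada (lineMatrix (pendantMap N)) + bessel 0 := by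
  obtain ⟨L, hL, hLk⟩ := exists_hasSum_excursion_bound hN
  have h1 := (hasSum_estrada_pendantMap (N + 1)).sub (hasSum_estrada_pendantMap N)
  have h2 := (((admissible_cycleWeight (N + 1)).hasSum_walkWeights.mul_left ((N : ℝ) + 1)).sub
    ((admissible_cycleWeight N).hasSum_walkWeights.mul_left (N : ℝ))).add hL
  have h3 := hasSum_le (fun k => ?_) h1 h2
  · have hN' : (3 : ℝ) ≤ N := by exact_mod_cast hN
    have hβ := bessel_pos N
    have t1 : ((N : ℝ) + 1) * total (cycleWeight (N + 1)) ≤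
        (N + 1) * bessel 0 + 5 / 2 * bessel N := by
      have e1 := total_cycleWeight_le (N := N + 1)
      have e2 := tail_le (N + 1) (by omega)
      have e3 := bessel_succ_le N
      push_cast at e2
      have e4 : ((N : ℝ) + 1) * tail (N + 1) ≤ 5 / 4 * bessel N := by
        calc _ ≤ ((N : ℝ) + 1) * (((N : ℝ) + 1 + 1) / (N + 1) * (bessel N / (N + 1))) := by
              gcongr
              exact e2.trans (by gcongr)
          _ = (((N : ℝ) + 2) / (N + 1)) * bessel N := by field_simp; ring
          _ ≤ _ := by
              refine mul_le_mul_of_nonneg_right ?_ hβ.le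
              rw [div_le_div_iff₀ (by positivity) (by positivity)]
              linarith
      calc _ ≤ ((N : ℝ) + 1) * (bessel 0 + 2 * tail (N + 1)) := by gcongr
        _ ≤ _ := by linarith
    have t2 : (N : ℝ) * bessel 0 + 2 * N * bessel N ≤ N * total (cycleWeight N) := by
      have := mul_le_mul_of_nonneg_left (le_total_cycleWeight (N := N)) (Nat.cast_nonneg (α := ℝ) N)
      linarith
    have t3 : 1 / ((N : ℝ) + 1) * (2 * (2 * tail N) * (((N : ℝ) + 2) / (N - 1))) ≤
        10 / 3 * bessel N := by
      have e1 := tail_le N (by omega)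
      have hN1 : (0 : ℝ) < N - 1 := by linarith
      calc _ ≤ 1 / ((N : ℝ) + 1) * (2 * (2 * (((N : ℝ) + 1) / N * bessel N)) *
            (((N : ℝ) + 2) / (N - 1))) := by gcongr
        _ = (4 * ((N : ℝ) + 2) / (N * (N - 1))) * bessel N := by field_simp; ring
        _ ≤ _ := by
            refine mul_le_mul_of_nonneg_right ?_ hβ.le
            rw [div_le_div_iff₀ (by positivity) (by positivity)]
            nlinarith
    -- The three bounds leave I_0 + (5/2 + 10/3 - 2N) I_N, and 35/6 < 6 ≤ 2N; both constants are the
    -- values of their decreasing expressions at N = 3.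
    nlinarith
  · simp only [← mul_div_assoc, ← sub_div]
    rcases eq_or_ne k 0 with rfl | hk
    · refine le_trans (le_of_eq ?_) (add_le_add_right (hLk 0) _)
      simp [ZMod.card, walkWeights, cycleWeight]
    · refine le_trans ?_ (add_le_add_right (hLk k) _)
      rw [← add_div]
      refine div_le_div_of_nonneg_right ?_ (by positivity)
      have e1 := trace_pow_pendantMap (N := N + 1) (by omega) hk
      have e2 := through_lineExcursionWeight_le hN hk
      have e3 := coeff_through_sub_le (walkWeights_nonneg lineExcursionWeight_nonneg)
        (walkWeights_mono (lineExcursionWeight_le (N := N + 1))) k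
      push_cast at e1
      linarith

theorem estrada_pendantMap_le_add {N : ℕ} [NeZero N] (hN : 2 < N) (n : ℕ) :
    estrada (lineMatrix (pendantMap (N + n))) ≤
      estrada (lineMatrix (pendantMap N)) + n * bessel 0 := by
  induction n with
  | zero => simp
  | succ n ih =>
    have : NeZero (N + n) := ⟨by omega⟩
    have := estrada_pendantMap_succ_lt (N := N + n) (by omega)
    change estrada (lineMatrix (pendantMap (N + n + 1))) ≤ _
    push_cast
    linarith

theorem estrada_pendantMap_lt_add {N : ℕ} [NeZero N] (hN : 2 < N) (n : ℕ) :
    estrada (lineMatrix (pendantMap (N + (n + 1)))) <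
      estrada (lineMatrix (pendantMap N)) + ((n : ℝ) + 1) * bessel 0 := by
  have : NeZero (N + n) := ⟨by omega⟩
  have h1 := estrada_pendantMap_succ_lt (N := N + n) (by omega)
  have h2 := estrada_pendantMap_le_add hN n
  change estrada (lineMatrix (pendantMap (N + n + 1))) < _
  linarith

end Growth

/-! ### From unicyclic graphs to functions and back. -/

section Graphs

variable {V W : Type*} {G : SimpleGraph V} {φ : V → V}

theorem sym2_injective_of_sq_ne (h : ∀ v, φ (φ v) ≠ v) :
    Function.Injective fun v => s(v, φ v) := by
  intro u v e
  rcases Sym2.eq_iff.1 e with h1 | h1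
  · exact h1.1
  · exact absurd (by rw [← h1.1, h1.2]) (h v)

theorem IsFunctional.card_edgeSet (h : IsFunctional G φ) :
    Nat.card G.edgeSet = Nat.card V := by
  let F : V → G.edgeSet := fun v => ⟨s(v, φ v), (h.adj _ _).2 (Or.inl rfl)⟩
  refine (Nat.card_congr (Equiv.ofBijective F ⟨fun u v e => ?_, ?_⟩)).symm
  · exact sym2_injective_of_sq_ne h.sq_ne (congrArg Subtype.val e)
  · rintro ⟨e, he⟩
    induction e using Sym2.ind with
    | _ u v =>
      rcases (h.adj u v).1 he with rfl | rfl
      · exact ⟨u, rfl⟩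
      · exact ⟨v, Subtype.ext Sym2.eq_swap⟩

theorem IsFunctional.nonempty_iso {H : SimpleGraph W} {ψ : W → W} (hG : IsFunctional G φ)
    (hH : IsFunctional H ψ) (e : V ≃ W) (he : ∀ v, ψ (e v) = e (φ v)) : Nonempty (G ≃g H) :=
  ⟨⟨e, by intro u v; rw [hG.adj, hH.adj, he, he, e.apply_eq_iff_eq, e.apply_eq_iff_eq]⟩⟩

theorem IsFunctional.of_iso {H : SimpleGraph W} {ψ : W → W} (hH : IsFunctional H ψ) (e : G ≃g H) :
    IsFunctional G fun v => e.symm (ψ (e v)) where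
  adj u v := by
    rw [← e.map_adj_iff, hH.adj]
    simp only [← e.injective.eq_iff, RelIso.apply_symm_apply]
  sq_ne v h := hH.sq_ne (e v) (by simpa using congrArg e h)

theorem exists_isFunctional_cycleGraph {m : ℕ} (hm : 2 < m) :
    ∃ (φ : Fin m → Fin m) (e : ZMod m ≃ Fin m), IsFunctional (SimpleGraph.cycleGraph m) φ ∧
      ∀ i, φ (e i) = e (i + 1) := by
  obtain ⟨k, rfl⟩ : ∃ k, m = k + 3 := ⟨m - 3, by omega⟩
  refine ⟨fun i => i + 1, Equiv.refl _, ⟨fun u v => ?_, fun v h => ?_⟩, fun _ => rfl⟩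
  · rw [SimpleGraph.cycleGraph_adj, sub_eq_iff_eq_add, sub_eq_iff_eq_add, or_comm]
    simp only [add_comm _ (1 : Fin (k + 3)), eq_comm]
  · have : (1 : Fin (k + 3)) + 1 = 0 := by simpa [add_assoc] using h
    have := congrArg Fin.val this
    rw [Fin.val_add, Fin.val_one, Fin.val_zero, Nat.mod_eq_of_lt (by omega)] at this
    omega

theorem exists_isFunctional_pendantCycle {m : ℕ} (hm : 2 < m) :
    ∃ (φ : Option (Fin m) → Option (Fin m)) (e : Option (ZMod m) ≃ Option (Fin m)),
      IsFunctional (SimpleGraph.pendantCycle m) φ ∧ ∀ v, φ (e v) = e (pendantMap m v) := by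
  obtain ⟨φ, e, h, he⟩ := exists_isFunctional_cycleGraph hm
  have : NeZero m := ⟨by omega⟩
  -- A rotation making 0 the index of the vertex that carries the pendant one.
  let e' : ZMod m ≃ Fin m := (Equiv.addRight (e.symm 0)).trans e
  have he' : ∀ i, φ (e' i) = e' (i + 1) := fun i => by
    simp only [e', Equiv.trans_apply, Equiv.coe_addRight, he]
    congr 1; ring
  have h0 : e' 0 = 0 := by simp [e']
  refine ⟨fun v => v.elim (some 0) fun i => some (φ i), Equiv.optionCongr e',
    ⟨fun u v => ?_, fun v => ?_⟩, fun v => ?_⟩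
  · rcases u with _ | i <;> rcases v with _ | j
    · simp [SimpleGraph.pendantCycle]
    · change j.val = 0 ↔ some 0 = some j ∨ some (φ j) = none
      simp only [Option.some_inj, reduceCtorEq, or_false, @eq_comm _ 0 j, Fin.ext_iff, Fin.val_zero]
    · change i.val = 0 ↔ some (φ i) = none ∨ some 0 = some i
      simp only [Option.some_inj, reduceCtorEq, false_or, @eq_comm _ 0 i, Fin.ext_iff, Fin.val_zero]
    · simpa [SimpleGraph.pendantCycle] using h.adj i j
  · rcases v with _ | i
    · simp
    · simpa using h.sq_ne i
  · rcases v with _ | i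
    · simp [pendantMap, h0]
    · simp [pendantMap, he']

theorem SLEE_cycleGraph {m : ℕ} [NeZero m] (hm : 2 < m) :
    (SimpleGraph.cycleGraph m).SLEE = Real.exp 2 * estrada (cycleMatrix m) := by
  obtain ⟨φ, e, h, he⟩ := exists_isFunctional_cycleGraph hm
  rw [h.SLEE_eq, ← lineMatrix_add_one hm, estrada_lineMatrix_congr e he]

theorem SLEE_pendantCycle {m : ℕ} [NeZero m] (hm : 2 < m) :
    (SimpleGraph.pendantCycle m).SLEE = Real.exp 2 * estrada (lineMatrix (pendantMap m)) := by
  obtain ⟨φ, e, h, he⟩ := exists_isFunctional_pendantCycle hm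
  rw [h.SLEE_eq, estrada_lineMatrix_congr e he]

theorem isUnicyclic_cycleGraph {m : ℕ} (hm : 2 < m) : (SimpleGraph.cycleGraph m).IsUnicyclic := by
  obtain ⟨φ, e, h, -⟩ := exists_isFunctional_cycleGraph hm
  obtain ⟨k, rfl⟩ : ∃ k, m = k + 1 := ⟨m - 1, by omega⟩
  exact ⟨SimpleGraph.cycleGraph_connected, h.card_edgeSet⟩

theorem isUnicyclic_pendantCycle {m : ℕ} (hm : 2 < m) :
    (SimpleGraph.pendantCycle m).IsUnicyclic := by
  obtain ⟨φ, e, h, -⟩ := exists_isFunctional_pendantCycle hm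
  obtain ⟨k, rfl⟩ : ∃ k, m = k + 1 := ⟨m - 1, by omega⟩
  refine ⟨?_, h.card_edgeSet⟩
  have hsome : ∀ i : Fin (k + 1), (SimpleGraph.pendantCycle (k + 1)).Reachable
      (some 0) (some i) := fun i =>
    (SimpleGraph.cycleGraph_connected.preconnected 0 i).map
      (⟨some, fun h => h⟩ : SimpleGraph.cycleGraph (k + 1) →g SimpleGraph.pendantCycle (k + 1))
  have hnone : (SimpleGraph.pendantCycle (k + 1)).Adj (some 0) none :=
    show ((0 : Fin (k + 1)).val = 0) from rfl
  refine (SimpleGraph.connected_iff_exists_forall_reachable _).2 ⟨some 0, fun v => ?_⟩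
  rcases v with _ | i
  · exact hnone.reachable
  · exact hsome i

variable [Fintype V]

/-- A unicyclic graph with a cycle of length `q` is the graph of a function that rotates the
cycle and moves all other vertices towards it. -/
theorem exists_isFunctional (hG : G.IsUnicyclic) {v : V} {c : G.Walk v v} (hc : c.IsCycle) {q : ℕ}
    (hq : c.length = q) [NeZero q] : ∃ (φ : V → V) (g : ZMod q → V) (d : V → ℕ),
      IsFunctional G φ ∧ g.Injective ∧ (∀ i, φ (g i) = g (i + 1)) ∧
        ∀ v ∉ Set.range g, d (φ v) < d v := by
  classical
  subst hq
  have hlen := hc.three_le_length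
  have : Fact (2 < c.length) := ⟨hlen⟩
  set g : ZMod c.length → V := fun i => c.getVert i.val with hg
  have hval : ∀ i : ZMod c.length, i.val < c.length := ZMod.val_lt
  have ginj : g.Injective := fun i j e => ZMod.val_injective _ <|
    hc.getVert_injOn' (by have := hval i; simp only [Set.mem_ofPred_eq]; omega)
      (by have := hval j; simp only [Set.mem_ofPred_eq]; omega) e
  have gadj : ∀ i, G.Adj (g i) (g (i + 1)) := by
    intro i
    have h1 := c.adj_getVert_succ (hval i)
    have h2 : g (i + 1) = c.getVert (i.val + 1) := by
      have e : i + 1 = ((i.val + 1 : ℕ) : ZMod c.length) := by simp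
      rw [hg]
      simp only
      rw [e, ZMod.val_natCast]
      rcases Nat.lt_or_ge (i.val + 1) c.length with h | h
      · rw [Nat.mod_eq_of_lt h]
      · have : i.val + 1 = c.length := by have := hval i; omega
        rw [this, Nat.mod_self, c.getVert_length, c.getVert_zero]
    rw [h2]; exact h1
  -- The rank d is the distance to the nearest cycle vertex; the parent is the next vertex on a
  -- shortest path there.
  have hmin : ∀ v : V, ∃ i, ∀ j, G.dist v (g i) ≤ G.dist v (g j) := fun v => by
    obtain ⟨i, -, hi⟩ := Finset.exists_min_image univ (fun i => G.dist v (g i))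
      ⟨0, Finset.mem_univ _⟩
    exact ⟨i, fun j => hi j (Finset.mem_univ j)⟩
  choose m hm using hmin
  have hpar : ∀ v : V, ∃ u, v ∉ Set.range g →
      G.Adj v u ∧ G.dist u (g (m u)) < G.dist v (g (m v)) := by
    intro v
    by_cases hv : v ∈ Set.range g
    · exact ⟨v, fun h => absurd hv h⟩
    · obtain ⟨p, hp⟩ := hG.1.exists_walk_length_eq_dist v (g (m v))
      obtain ⟨u, h, p, rfl⟩ := p.exists_eq_cons_of_ne fun e => hv ⟨m v, e.symm⟩
      refine ⟨u, fun _ => ⟨h, ?_⟩⟩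
      rw [← hp, SimpleGraph.Walk.length_cons]
      exact Nat.lt_succ_of_le ((hm u (m v)).trans (SimpleGraph.dist_le p))
  choose par hpar using hpar
  let φ : V → V := fun v => if h : v ∈ Set.range g then g (h.choose + 1) else par v
  have φg : ∀ i, φ (g i) = g (i + 1) := by
    intro i
    have h : g i ∈ Set.range g := ⟨i, rfl⟩
    simp only [φ, dif_pos h]
    rw [ginj h.choose_spec]
  have φo : ∀ v ∉ Set.range g, φ v = par v := fun v hv => dif_neg hv
  have φadj : ∀ v, G.Adj v (φ v) := by
    intro v
    by_cases hv : v ∈ Set.range g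
    · obtain ⟨i, rfl⟩ := hv
      rw [φg]; exact gadj i
    · rw [φo v hv]; exact (hpar v hv).1
  have hd : ∀ v ∉ Set.range g, G.dist (φ v) (g (m (φ v))) < G.dist v (g (m v)) := fun v hv => by
    rw [φo v hv]; exact (hpar v hv).2
  have φsq : ∀ v, φ (φ v) ≠ v := by
    intro v e
    by_cases hv : v ∈ Set.range g
    · obtain ⟨i, rfl⟩ := hv
      rw [φg, φg] at e
      have e := ginj e
      have h2 : ((2 : ℕ) : ZMod c.length) = 0 := by
        push_cast
        linear_combination e
      rw [ZMod.natCast_eq_zero_iff] at h2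
      exact absurd (Nat.le_of_dvd two_pos h2) (by omega)
    · by_cases hv' : φ v ∈ Set.range g
      · obtain ⟨i, hi⟩ := hv'
        exact hv ⟨i + 1, by rw [← φg, hi, e]⟩
      · have h1 := hd v hv
        have h2 := hd _ hv'
        rw [e] at h2
        omega
  refine ⟨φ, g, fun v => G.dist v (g (m v)), ⟨fun u v => ⟨fun h => ?_, ?_⟩, φsq⟩, ginj, φg, hd⟩
  -- Injective by `φsq`, hence bijective as there are as many edges as vertices: no edge of G is
  -- missed.
  · let F : V → G.edgeSet := fun v => ⟨s(v, φ v), φadj v⟩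
    have hF : F.Injective := fun u v e =>
      sym2_injective_of_sq_ne φsq (congrArg Subtype.val e)
    obtain ⟨w, hw⟩ := (hF.bijective_of_nat_card_le hG.2.le).surjective ⟨s(u, v), h⟩
    rcases Sym2.eq_iff.1 (congrArg Subtype.val hw) with h1 | h1
    · exact Or.inl (by rw [← h1.1, h1.2])
    · exact Or.inr (by rw [← h1.1, h1.2])
  · rintro (rfl | rfl)
    · exact φadj u
    · exact (φadj v).symm

/-- A vertex of least rank off the cycle maps into the cycle, so it can serve as the pendant vertex
once the cycle is rotated. -/
theorem exists_semiconj_pendantMap {q : ℕ} [NeZero q] {g : ZMod q → V} (hg : g.Injective)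
    (hφ : ∀ i, φ (g i) = g (i + 1)) {d : V → ℕ} (hd : ∀ v ∉ Set.range g, d (φ v) < d v)
    (hq : q < Fintype.card V) : ∃ f : Option (ZMod q) → V, f.Injective ∧
      (∀ v, φ (f v) = f (pendantMap q v)) ∧ ∀ v ∉ Set.range f, d (φ v) < d v := by
  classical
  have hex : (univ.filter fun v => v ∉ Set.range g).Nonempty := by
    by_contra h
    rw [Finset.not_nonempty_iff_eq_empty, Finset.filter_eq_empty_iff] at h
    have hs : g.Surjective := fun v => not_not.1 (h (Finset.mem_univ v))
    have := Fintype.card_le_of_surjective g hs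
    rw [ZMod.card] at this
    omega
  obtain ⟨y, hy, hmin⟩ := Finset.exists_min_image _ d hex
  simp only [Finset.mem_filter, Finset.mem_univ, true_and] at hy hmin
  obtain ⟨a, ha⟩ : φ y ∈ Set.range g := by
    by_contra h
    have h1 := hmin _ h
    have h2 := hd y hy
    omega
  refine ⟨fun v => v.elim y fun i => g (i + a), ?_, ?_, fun v hv => hd v fun ⟨i, hi⟩ =>
    hv ⟨some (i - a), by simpa using hi⟩⟩
  · rintro (_ | i) (_ | j) e
    · rfl
    · exact absurd ⟨_, e.symm⟩ hy
    · exact absurd ⟨_, e⟩ hy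
    · simpa using hg e
  · rintro (_ | i)
    · simp [pendantMap, ha]
    · simp only [pendantMap, Option.elim_some, hφ]
      congr 1; ring

theorem exists_isCycle (hG : G.IsUnicyclic) : ∃ (v : V) (c : G.Walk v v), c.IsCycle := by
  classical
  by_contra h
  push Not at h
  have ht : G.IsTree := ⟨hG.1, fun v c => h v c⟩
  have h1 := ht.card_edgeFinset
  have h2 := hG.2
  rw [Nat.card_eq_fintype_card, Nat.card_eq_fintype_card, ← SimpleGraph.edgeFinset_card] at h2
  omega

theorem card_lt_or_nonempty_iso_cycleGraph {q : ℕ} [NeZero q] (hq : 2 < q) (h : IsFunctional G φ)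
    {g : ZMod q → V} (hg : g.Injective) (hφ : ∀ i, φ (g i) = g (i + 1)) :
    q < Fintype.card V ∨ Nonempty (G ≃g SimpleGraph.cycleGraph (Fintype.card V)) := by
  have h1 := Fintype.card_le_of_injective g hg
  rw [ZMod.card] at h1
  rcases h1.lt_or_eq with h1 | h1
  · exact Or.inl h1
  · right
    rw [← h1]
    have hb : g.Bijective := (Fintype.bijective_iff_injective_and_card g).2
      ⟨hg, by rw [ZMod.card, h1]⟩
    obtain ⟨ψ, e, hψ, he⟩ := exists_isFunctional_cycleGraph hq
    refine h.nonempty_iso hψ ((Equiv.ofBijective g hb).symm.trans e) fun v => ?_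
    obtain ⟨i, rfl⟩ := hb.surjective v
    rw [hφ]
    have hs : ∀ j, (Equiv.ofBijective g hb).symm (g j) = j := fun j =>
      (Equiv.ofBijective g hb).symm_apply_apply j
    simp [hs, he]

variable [DecidableEq V] [DecidableRel G.Adj]

theorem SLEE_eq_of_nonempty_iso_pendantCycle {m : ℕ} (hm : 2 < m)
    (h : Nonempty (G ≃g SimpleGraph.pendantCycle m)) :
    (SimpleGraph.pendantCycle m).SLEE = G.SLEE := by
  obtain ⟨e⟩ := h
  obtain ⟨ψ, -, hψ, -⟩ := exists_isFunctional_pendantCycle hm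
  rw [hψ.SLEE_eq, (hψ.of_iso e).SLEE_eq]
  exact congrArg _ (estrada_lineMatrix_congr (φ := fun v => e.symm (ψ (e v))) e.toEquiv
    fun v => by simp).symm

/-- G contains a cycle with a pendant vertex. If this is not everything, trading each remaining
vertex for one more vertex on the cycle lowers the index strictly. -/
theorem nonempty_iso_or_SLEE_pendantCycle_lt {q : ℕ} [NeZero q] (hq : 2 < q)
    (h : IsFunctional G φ) {g : ZMod q → V} (hg : g.Injective) (hφ : ∀ i, φ (g i) = g (i + 1))
    {d : V → ℕ} (hd : ∀ v ∉ Set.range g, d (φ v) < d v) (hqn : q < Fintype.card V) :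
    (q = Fintype.card V - 1 → Nonempty (G ≃g SimpleGraph.pendantCycle (Fintype.card V - 1))) ∧
      (q ≠ Fintype.card V - 1 →
        (SimpleGraph.pendantCycle (Fintype.card V - 1)).SLEE < G.SLEE) := by
  obtain ⟨f, hf, hfφ, hfd⟩ := exists_semiconj_pendantMap hg hφ hd hqn
  constructor
  · intro e
    rw [← e]
    have hb : f.Bijective := (Fintype.bijective_iff_injective_and_card f).2
      ⟨hf, by rw [Fintype.card_option, ZMod.card]; omega⟩
    obtain ⟨ψ, e', hψ, he⟩ := exists_isFunctional_pendantCycle hq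
    refine h.nonempty_iso hψ ((Equiv.ofBijective f hb).symm.trans e') fun v => ?_
    obtain ⟨i, rfl⟩ := hb.surjective v
    rw [hfφ]
    have hs : ∀ j, (Equiv.ofBijective f hb).symm (f j) = j := fun j =>
      (Equiv.ofBijective f hb).symm_apply_apply j
    simp [hs, he]
  · intro e
    obtain ⟨n, hn⟩ : ∃ n, Fintype.card V = q + 1 + (n + 1) := ⟨Fintype.card V - q - 2, by omega⟩
    have hn1 : Fintype.card V - 1 = q + (n + 1) := by omega
    rw [hn1, SLEE_pendantCycle (by omega), h.SLEE_eq]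
    refine mul_lt_mul_of_pos_left ?_ (Real.exp_pos 2)
    refine (estrada_pendantMap_lt_add hq n).trans_le ?_
    refine hasSum_le (fun k => ?_) ((hasSum_estrada_pendantMap q).add
      (hasSum_centralWalks.mul_left ((n : ℝ) + 1))) (hasSum_estrada (isHermitian_lineMatrix φ))
    rw [← mul_div_assoc, ← add_div]
    refine div_le_div_of_nonneg_right ?_ (by positivity)
    have := trace_pow_lineMatrix_ge h.sq_ne h.ne hf hfφ hfd hn k
    push_cast at this
    exact this

end Graphs

end SignlessEstrada

open SignlessEstrada

theorem mainTheorem2 {V : Type*} [Fintype V] [DecidableEq V] (G : SimpleGraph V)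
    [DecidableRel G.Adj] (hG : G.IsUnicyclic) (n q : ℕ) (hn : Fintype.card V = n)
    (v : V) (c : G.Walk v v) (hc : c.IsCycle) (hcq : c.length = q) (hq : q < n) :
    -- the chain of inequalities, for the cycle of `G` as well as for the cycle on `n` vertices
    (SimpleGraph.cycleGraph q).SLEE < (SimpleGraph.pendantCycle (n - 1)).SLEE ∧
    (SimpleGraph.cycleGraph n).SLEE < (SimpleGraph.pendantCycle (n - 1)).SLEE ∧
    (SimpleGraph.pendantCycle (n - 1)).SLEE ≤ G.SLEE ∧
    -- the case of equality
    ((SimpleGraph.pendantCycle (n - 1)).SLEE = G.SLEE ↔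
      Nonempty (G ≃g SimpleGraph.pendantCycle (n - 1))) ∧
    (Nonempty (G ≃g SimpleGraph.pendantCycle (n - 1)) ↔ q = n - 1) ∧
    -- the smallest and the second smallest value among all unicyclic graphs on `n` vertices
    (SimpleGraph.cycleGraph n).IsUnicyclic ∧
    (SimpleGraph.pendantCycle (n - 1)).IsUnicyclic ∧
    (∀ (H : SimpleGraph V) [DecidableRel H.Adj], H.IsUnicyclic →
      Nonempty (H ≃g SimpleGraph.cycleGraph n) ∨
      Nonempty (H ≃g SimpleGraph.pendantCycle (n - 1)) ∨
      (SimpleGraph.pendantCycle (n - 1)).SLEE < H.SLEE) := by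
  subst hn
  have hq3 : 2 < q := hcq ▸ hc.three_le_length
  have : NeZero q := ⟨by omega⟩
  have : NeZero (Fintype.card V) := ⟨by omega⟩
  have : NeZero (Fintype.card V - 1) := ⟨by omega⟩
  have hm : 2 < Fintype.card V - 1 := by omega
  have hcycle : ∀ p : ℕ, 2 < p → p ≤ Fintype.card V →
      (SimpleGraph.cycleGraph p).SLEE < (SimpleGraph.pendantCycle (Fintype.card V - 1)).SLEE := by
    intro p hp hpn
    have : NeZero p := ⟨by omega⟩
    rw [SLEE_cycleGraph hp, SLEE_pendantCycle hm]
    exact mul_lt_mul_of_pos_left (estrada_cycleMatrix_lt hp hm (by omega)) (Real.exp_pos 2)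
  obtain ⟨φ, g, d, hφ, hg, hgφ, hd⟩ := exists_isFunctional hG hc hcq
  obtain ⟨hiso, hlt⟩ := nonempty_iso_or_SLEE_pendantCycle_lt hq3 hφ hg hgφ hd hq
  have heq := SLEE_eq_of_nonempty_iso_pendantCycle (G := G) hm
  have hback : (SimpleGraph.pendantCycle (Fintype.card V - 1)).SLEE = G.SLEE →
      q = Fintype.card V - 1 := fun h => by
    by_contra hne
    exact (hlt hne).ne h
  refine ⟨hcycle q hq3 hq.le, hcycle _ (by omega) le_rfl, ?_, ⟨fun h => hiso (hback h), heq⟩,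
    ⟨fun h => hback (heq h), hiso⟩, isUnicyclic_cycleGraph (by omega),
    isUnicyclic_pendantCycle hm, fun H _ hH => ?_⟩
  · by_cases h : q = Fintype.card V - 1
    · exact (heq (hiso h)).le
    · exact (hlt h).le
  -- H has a cycle of its own: either it spans H, or the dichotomy used for G applies to H.
  · obtain ⟨u, c', hc'⟩ := exists_isCycle hH
    have hp3 := hc'.three_le_length
    have : NeZero c'.length := ⟨by omega⟩
    obtain ⟨φ, g, d, hφ, hg, hgφ, hd⟩ := exists_isFunctional hH hc' rfl
    rcases card_lt_or_nonempty_iso_cycleGraph hp3 hφ hg hgφ with hpn | h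
    · right
      obtain ⟨hiso, hlt⟩ := nonempty_iso_or_SLEE_pendantCycle_lt hp3 hφ hg hgφ hd hpn
      by_cases h : c'.length = Fintype.card V - 1
      · exact Or.inl (hiso h)
      · exact Or.inr (hlt h)
    · exact Or.inl h
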